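/- **Setting.** A *tree system of cut pairs* $\Theta$ consists of: a countable bipartite tree $T$ with vertex set $V\sqcup W$ in which every $w\in W$ has finite valence at least $2$; a compact metrizable space $M_v$ for each $v\in V$ and a discrete two-point space $M_w$ for each $w\in W$; an injection $i_e\colon M_w\to M_v$ for each edge $e=(v,w)$, such that the images of $i_e$ and $i_{e'}$ in $M_v$ have at most one common point for distinct edges $e,e'$ at $v$, and such that for each $v$ the collection of the pairs $i_e(M_w)$, $e=(v,w)$, is null in $M_v$ (for every $\epsilon>0$ only finitely many members have diameter at least $\epsilon$). A *compatible family of metrics* is a family $(d_u)_{u\in V\sqcup W}$ of metrics inducing the topologies of the $M_u$ for which all $i_e$ are isometric embeddings. The *total space* $M_T$ is the quotient of $\bigsqcup_u M_u$ by the equivalence relation $\sim$ generated by $x\sim i_e(x)$, with the quotient metric $d$: $d(x,y)$ is the infimum of $\sum_i d_{u_i}(p_i,q_i)$ over all finite chains $p_1,q_1,\dots,p_m,q_m$ with $p_1\sim x$, $q_m\sim y$, $p_i,q_i\in M_{u_i}$ and $q_i\sim p_{i+1}$. For a set $S$ of vertices, $M_S\subseteq M_T$ is the union of the images of the $M_u$,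 $u\in S$. Fix $v_0\in V$. The family is *shrinking* with respect to $v_0$ if (i) $\operatorname{diam}(M_v)\le 2^{-k}$ in $M_T$ whenever $v\in V$ is at distance $2k$ from $v_0$ in $T$, and (ii) for every $v\in V\setminus\{v_0\}$, $\operatorname{diam}(M_v)=\operatorname{diam}(M_w)$, where $w$ is the neighbour of $v$ on the path from $v$ to $v_0$. For an end $x\in\partial T$ (a class of rays, two rays being equivalent if they have a common tail), a sequence $(p_n)$ in $M_T$ is *associated* to $x$ if there is a ray $(v_1,w_1,v_2,w_2,\dots)$ representing $x$, with $v_i\in V$ and $w_i\in W$, such that $p_n\in M_{w_n}$ for all $n$. The end $x$ is *redundant* if some associated sequence is eventually constant; $\partial_0T$ is the set of non-redundant ends. For a non-empty finite subtree $F$ of $T$, let $\mathcal C_F$ be the collection of the pairs $M_w\subseteq M_F$, where $(v,w)$ runs over the edges of $T$ with exactly one endpoint in $F$. The *kettlebell space* $M_F^*$ is $M_F$ (with the metric $d$) with an arc $[0,d(a,b)]$ glued along its endpoints to $a,b$ for each $\{a,b\}\in\mathcal C_F$, with the quotient metric. If $F'=F\cup e$ for an edge $e=(v,w)$ with exactly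 one endpoint in $F$, and $M_w=\{a,b\}$, then $f_{F'F}\colon M_{F'}^*\to M_F^*$ is the identity on $M_F$ and on the arcs of $M_{F'}^*$ that belong to $M_F^*$, and sends every other point $y$ (these lie in $M_v$ and in the arcs attached to $M_v$, and exist only if $v\notin F$) to the point $\frac{d(y,a)}{d(y,a)+d(y,b)}\,d(a,b)$ of the arc of $M_F^*$ corresponding to $\{a,b\}$. For general $F\subseteq F'$, $f_{F'F}$ is the composition of such maps along a chain from $F'$ to $F$. Let $M_\Theta=\varprojlim M_F^*$. The *natural map* $\gamma\colon M_T\to M_\Theta$ is given by $\gamma(x)_F=f_{F'F}(x)$ for any $F'\supseteq F$ with $x\in M_{F'}$. **Theorem.** Let $\Theta$ be a tree system of cut pairs with a compatible family of metrics that is shrinking with respect to some $v_0\in V$. Then $(M_T,d)$ is a totally bounded metric space, so its completion $\bar M_T$ is compact, and every $(M_u,d_u)$, $u\in V\sqcup W$, embeds isometrically into $\bar M_T$. The natural map $\gamma\colon M_T\to M_\Theta$ is well defined, and it extends uniquely to a continuous map $\bar\gamma\colon\bar M_T\to M_\Theta$, which is a homeomorphism. Moreover, there are maps $\partial\alpha\colon\partial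 T\to\bar M_T$ and $\partial\gamma\colon\partial T\to M_\Theta$ such that $p_n\to\partial\alpha(x)$ and $\gamma(p_n)\to\partial\gamma(x)$ for every $x\in\partial T$ and every sequence $(p_n)$ associated to $x$; the map $\partial\alpha$ restricts to a bijection $\partial_0T\to\bar M_T\setminus M_T$, the map $\partial\gamma$ restricts to a bijection $\partial_0T\to M_\Theta\setminus\gamma(M_T)$, and $\bar\gamma(\partial\alpha(x))=\partial\gamma(x)$ for all $x\in\partial_0T$. -/

import Mathlib

open Set Filter Topology
open scoped ENNReal

universe u

/-! ## Gluing metric spaces: total spaces with the quotient pseudometric -/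

/-- The space `X_⊔ / ∼`, where `X_⊔` is the disjoint union of the `X i` and `∼` is the
equivalence relation generated by `r`. -/
def Glue {ι : Type u} (X : ι → Type u) (r : (Σ i, X i) → (Σ i, X i) → Prop) : Type u :=
  Quot r

namespace Glue

variable {ι : Type u} {X : ι → Type u} {r : (Σ i, X i) → (Σ i, X i) → Prop}

/-- The class of a point of the piece `X i` in the glued space. -/
def mk (r : (Σ i, X i) → (Σ i, X i) → Prop) (i : ι) (p : X i) : Glue X r :=
  Quot.mk r ⟨i, p⟩

theorem ind {P : Glue X r → Prop} (h : ∀ i p, P (mk r i p)) (a : Glue X r) : P a :=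
  Quot.ind (fun s => h s.1 s.2) a

variable [∀ i, PseudoEMetricSpace (X i)]

/-- `IsChain r x y c`: there is a linking chain `(p₁, q₁, p₂, q₂, …, pₘ, qₘ)` of length `c`
from the class `x` of `p₁` to the class `y` of `qₘ`: for every `i` the points `pᵢ, qᵢ` lie in
the same piece, `qᵢ ∼ pᵢ₊₁` (that is, they have the same class), and `c` is the sum of the
distances of `pᵢ` and `qᵢ` (chains with `pᵢ`, `qᵢ` in different pieces have infinite length
and do not matter for the infimum). -/
inductive IsChain (r : (Σ i, X i) → (Σ i, X i) → Prop) : Glue X r → Glue X r → ℝ≥0∞ → Prop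
  | single (i : ι) (p q : X i) : IsChain r (mk r i p) (mk r i q) (edist p q)
  | cons (i : ι) (p q : X i) {z : Glue X r} {c : ℝ≥0∞} (h : IsChain r (mk r i q) z c) :
      IsChain r (mk r i p) z (edist p q + c)

theorem IsChain.trans {x y z : Glue X r} {c c' : ℝ≥0∞} (h : IsChain r x y c)
    (h' : IsChain r y z c') : IsChain r x z (c + c') := by
  induction h with
  | single i p q => exact IsChain.cons i p q h'
  | cons i p q _ ih =>
    rw [add_assoc]
    exact IsChain.cons i p q (ih h')

theorem IsChain.symm {x y : Glue X r} {c : ℝ≥0∞} (h : IsChain r x y c) : IsChain r y x c := by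
  induction h with
  | single i p q =>
    rw [edist_comm]
    exact IsChain.single i q p
  | cons i p q _ ih =>
    rw [add_comm, edist_comm]
    exact ih.trans (IsChain.single i q p)

/-- The quotient pseudometric: the infimum of the lengths of linking chains. -/
noncomputable instance : PseudoEMetricSpace (Glue X r) where
  edist x y := sInf {c | IsChain r x y c}
  edist_self x := by
    induction x using ind with
    | h i p =>
      have h : sInf {c | IsChain r (mk r i p) (mk r i p) c} ≤ edist p p :=
        sInf_le (IsChain.single i p p)
      simpa using h
  edist_comm x y := by
    congr 1
    ext c
    exact ⟨IsChain.symm, IsChain.symm⟩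
  edist_triangle x y z := by
    rw [ENNReal.sInf_add]
    refine le_iInf₂ fun c hc => ?_
    rw [add_comm, ENNReal.sInf_add]
    refine le_iInf₂ fun c' hc' => ?_
    rw [add_comm]
    exact sInf_le (IsChain.trans hc hc')

theorem edist_mk_le (i : ι) (p q : X i) : edist (mk r i p) (mk r i q) ≤ edist p q :=
  sInf_le (IsChain.single i p q)

end Glue

/-! ## Tree systems of cut pairs -/

/-- A collection `𝒞` of subsets of a topological space `X` (to be used for compact metrizable
`X`) is null if, for a metric inducing the topology and every `ε > 0`, only finitely many members
have diameter at least `ε`. For compact metrizable `X` this does not depend on the metric. -/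
def IsNullCollection {X : Type u} [t : TopologicalSpace X] (𝒞 : Set (Set X)) : Prop :=
  ∀ m : MetricSpace X, m.toUniformSpace.toTopologicalSpace = t →
    ∀ ε : ℝ, 0 < ε → {C ∈ 𝒞 | ε ≤ Metric.diam C}.Finite

/-- A tree system of cut pairs over a bipartite tree with vertex set `V ⊔ W`. -/
structure TreeSystem (V W : Type u) where
  /-- the underlying tree -/
  T : SimpleGraph (V ⊕ W)
  isTree : T.IsTree
  countable : Countable (V ⊕ W)
  not_adj_inl : ∀ v v' : V, ¬ T.Adj (.inl v) (.inl v')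
  not_adj_inr : ∀ w w' : W, ¬ T.Adj (.inr w) (.inr w')
  finite_valence : ∀ w : W, (T.neighborSet (.inr w)).Finite
  two_le_valence : ∀ w : W, 2 ≤ (T.neighborSet (.inr w)).ncard
  /-- the vertex spaces: the constituent spaces `M (inl v)` and the pairs `M (inr w)` -/
  M : V ⊕ W → Type u
  [top : ∀ v : V, TopologicalSpace (M (.inl v))]
  [compact : ∀ v : V, CompactSpace (M (.inl v))]
  [metrizable : ∀ v : V, TopologicalSpace.MetrizableSpace (M (.inl v))]
  card_pair : ∀ w : W, Nat.card (M (.inr w)) = 2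
  /-- the injections `i_e` for the edges `e = (v, w)` -/
  i : ∀ {v : V} {w : W}, T.Adj (.inl v) (.inr w) → M (.inr w) → M (.inl v)
  i_injective : ∀ {v : V} {w : W} (h : T.Adj (.inl v) (.inr w)), Function.Injective (i h)
  inter_subsingleton : ∀ {v : V} {w w' : W} (h : T.Adj (.inl v) (.inr w))
    (h' : T.Adj (.inl v) (.inr w')), w ≠ w' → (range (i h) ∩ range (i h')).Subsingleton
  null : ∀ v : V, IsNullCollection
    {C : Set (M (.inl v)) | ∃ (w : W) (h : T.Adj (.inl v) (.inr w)), C = range (i h)}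

namespace TreeSystem

variable {V W : Type u}

section System

variable (Θ : TreeSystem V W)

theorem exists_pair (w : W) : ∃ x y : Θ.M (.inr w), x ≠ y ∧ {x, y} = (univ : Set _) :=
  Nat.card_eq_two_iff.1 (Θ.card_pair w)

/-- The two points of the pair `M_w`, in a chosen order. -/
noncomputable def pt₀ (w : W) : Θ.M (.inr w) := (Θ.exists_pair w).choose

/-- The two points of the pair `M_w`, in a chosen order. -/
noncomputable def pt₁ (w : W) : Θ.M (.inr w) := (Θ.exists_pair w).choose_spec.choose

/-- A compatible family of metrics: a metric on every vertex space, inducing the given topology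
(on the finite space `M_w` every metric induces the discrete topology), such that all the maps
`i_e` are isometries. -/
structure CompatibleMetrics where
  met : ∀ u : V ⊕ W, MetricSpace (Θ.M u)
  top_eq : ∀ v : V, (met (.inl v)).toUniformSpace.toTopologicalSpace = Θ.top v
  dist_i : ∀ {v : V} {w : W} (h : Θ.T.Adj (.inl v) (.inr w)) (x y : Θ.M (.inr w)),
    (met (.inl v)).dist (Θ.i h x) (Θ.i h y) = (met (.inr w)).dist x y

/-- The finite subtrees of `T` (non-empty, given by their vertex sets). -/
structure FinSubtree where
  verts : Set (V ⊕ W)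
  finite : verts.Finite
  connected : (Θ.T.induce verts).Connected

variable {Θ}

/-- The edges in `N_F` are the edges `(v, w)` with exactly one end in `F`. The members
`C_e`, `e ∈ N_F`, of the peripheral collection of `F` are the pairs `M_w ⊆ M_F` for the vertices
`w` of such edges, and distinct `w` give distinct pairs; so they are indexed by these `w`. -/
def FinSubtree.periph (F : Θ.FinSubtree) : Set W :=
  {w | ∃ v, Θ.T.Adj (.inl v) (.inr w) ∧ ¬ (Sum.inl v ∈ F.verts ↔ Sum.inr w ∈ F.verts)}

/-- `F'` augments `F` along the edge `e = (v, w) ∈ N_F`: `F' = F ∪ e`. -/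
structure FinSubtree.Augments (F F' : Θ.FinSubtree) (v : V) (w : W) : Prop where
  adj : Θ.T.Adj (.inl v) (.inr w)
  exactly_one : ¬ (Sum.inl v ∈ F.verts ↔ Sum.inr w ∈ F.verts)
  verts_eq : F'.verts = F.verts ∪ {.inl v, .inr w}

theorem FinSubtree.Augments.mem_periph {F F' : Θ.FinSubtree} {v : V} {w : W}
    (h : F.Augments F' v w) : w ∈ F.periph := ⟨v, h.adj, h.exactly_one⟩

end System

/-! ### Ends of the tree -/

/-- A ray in a graph. -/
structure Ray {α : Type u} (G : SimpleGraph α) where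
  toFun : ℕ → α
  injective : Function.Injective toFun
  adj : ∀ n, G.Adj (toFun n) (toFun (n + 1))

/-- Two rays in a tree are equivalent if they have a common tail. -/
def raySetoid {α : Type u} (G : SimpleGraph α) : Setoid (Ray G) where
  r ρ σ := ∃ m n, ∀ k, ρ.toFun (m + k) = σ.toFun (n + k)
  iseqv :=
    { refl := fun _ => ⟨0, 0, fun _ => rfl⟩
      symm := fun ⟨m, n, h⟩ => ⟨n, m, fun k => (h k).symm⟩
      trans := by
        rintro ρ σ τ ⟨m, n, h⟩ ⟨m', n', h'⟩
        refine ⟨m + m', n' + n, fun k => ?_⟩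
        rw [add_assoc, h, add_assoc, ← h']
        congr 1
        omega }

/-- The set `∂T` of ends of the tree. -/
def Ends (Θ : TreeSystem V W) : Type u := Quotient (raySetoid Θ.T)

namespace CompatibleMetrics

variable {Θ : TreeSystem V W} (D : Θ.CompatibleMetrics)

/-- The vertex space `M_u` as a metric space with the metric `d_u`. -/
def X (_ : Θ.CompatibleMetrics) (u : V ⊕ W) : Type u := Θ.M u

noncomputable instance (u : V ⊕ W) : MetricSpace (D.X u) := D.met u

/-- The map `i_e` as a map of metric spaces. -/
def i {v : V} {w : W} (h : Θ.T.Adj (.inl v) (.inr w)) (x : D.X (.inr w)) : D.X (.inl v) :=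
  Θ.i h x

/-- The relation generating the gluing: `x ∼ i_e(x)` for `e = (v, w)` and `x ∈ M_w`. -/
inductive Rel : (Σ u, D.X u) → (Σ u, D.X u) → Prop
  | edge {v : V} {w : W} (h : Θ.T.Adj (.inl v) (.inr w)) (x : D.X (.inr w)) :
      Rel ⟨.inr w, x⟩ ⟨.inl v, D.i h x⟩

/-- The total space `M_T`. -/
def MT : Type u := Glue D.X D.Rel

/-- The map from a vertex space to the total space. -/
def toMT (u : V ⊕ W) (p : D.X u) : D.MT := Glue.mk D.Rel u p

theorem toMT_i {v : V} {w : W} (h : Θ.T.Adj (.inl v) (.inr w)) (x : D.X (.inr w)) :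
    D.toMT (.inr w) x = D.toMT (.inl v) (D.i h x) := Quot.sound (Rel.edge h x)

noncomputable instance : PseudoEMetricSpace D.MT :=
  inferInstanceAs (PseudoEMetricSpace (Glue D.X D.Rel))

theorem edist_toMT_ne_top (u : V ⊕ W) (p q : D.X u) :
    edist (D.toMT u p) (D.toMT u q) ≠ ⊤ :=
  ne_top_of_le_ne_top (edist_ne_top p q) (Glue.edist_mk_le u p q)

theorem exists_edist_adj {u u' : V ⊕ W} (h : Θ.T.Adj u u') (p : D.X u) :
    ∃ q : D.X u', edist (D.toMT u p) (D.toMT u' q) ≠ ⊤ := by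
  rcases u with v | w <;> rcases u' with v' | w'
  · exact absurd h (Θ.not_adj_inl v v')
  · let q : D.X (.inr w') := Θ.pt₀ w'
    exact ⟨q, by rw [D.toMT_i h]; exact D.edist_toMT_ne_top _ _ _⟩
  · exact ⟨D.i h.symm p, by rw [← D.toMT_i h.symm]; exact D.edist_toMT_ne_top _ _ _⟩
  · exact absurd h (Θ.not_adj_inr w w')

theorem edist_ne_top_MT (x y : D.MT) : edist x y ≠ ⊤ := by
  induction x using Glue.ind with
  | h u p =>
    induction y using Glue.ind with
    | h u' q =>
      obtain ⟨ω⟩ := Θ.isTree.connected.preconnected u u'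
      induction ω with
      | nil => exact D.edist_toMT_ne_top _ p q
      | cons h _ ih =>
        obtain ⟨p', hp'⟩ := D.exists_edist_adj h p
        exact ne_top_of_le_ne_top (ENNReal.add_ne_top.2 ⟨hp', ih p' q⟩)
          (edist_triangle _ _ _)

/-- The quotient (pseudo)metric `d` on `M_T`. -/
noncomputable instance : PseudoMetricSpace D.MT :=
  PseudoEMetricSpace.toPseudoMetricSpace D.edist_ne_top_MT

/-- The subspace `M_S` of `M_T`, for a set `S` of vertices. -/
def sub (S : Set (V ⊕ W)) : Set D.MT := {x | ∃ u ∈ S, ∃ p : D.X u, x = D.toMT u p}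

/-- The family of metrics is shrinking with respect to `v₀`: `M_v` has diameter at most `2⁻ᵏ` in
`M_T` if `v` is at distance `2k` from `v₀`, and, if `v ≠ v₀`, then the diameter of `M_v` is
attained by the pair `M_w` along which `M_v` is glued to the side of `v₀`, `w` being the
neighbour of `v` that is closer to `v₀`. -/
structure IsShrinking (v₀ : V) : Prop where
  diam_le : ∀ (v : V) (k : ℕ), Θ.T.dist (.inl v₀) (.inl v) = 2 * k →
    Metric.diam (D.sub {.inl v}) ≤ (1 / 2) ^ k
  diam_eq : ∀ (v : V) (w : W), Θ.T.Adj (.inl v) (.inr w) →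
    Θ.T.dist (.inl v₀) (.inr w) < Θ.T.dist (.inl v₀) (.inl v) →
    Metric.diam (D.sub {.inl v}) = Metric.diam (D.sub {.inr w})

/-! ### Associated sequences and redundant ends -/

/-- `p` is an associated sequence for the end `x`: for some ray `(v₀, w₀, v₁, w₁, …)`
representing `x` we have `p n ∈ M_{w n}` for all `n`. -/
def IsAssociated (x : Θ.Ends) (p : ℕ → D.MT) : Prop :=
  ∃ (ρ : Ray Θ.T) (v : ℕ → V) (w : ℕ → W), Quotient.mk (raySetoid Θ.T) ρ = x ∧
    (∀ n, ρ.toFun (2 * n) = .inl (v n)) ∧ (∀ n, ρ.toFun (2 * n + 1) = .inr (w n)) ∧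
    ∀ n, p n ∈ D.sub {.inr (w n)}

/-- An end is redundant if some associated sequence is eventually constant. -/
def IsRedundant (x : Θ.Ends) : Prop :=
  ∃ (q : D.MT) (N : ℕ) (p : ℕ → D.MT), D.IsAssociated x p ∧ ∀ n, N < n → p n = q

/-- The set `∂₀T` of non-redundant ends. -/
def nonRedundant : Set Θ.Ends := {x | ¬ D.IsRedundant x}

/-! ### Kettlebell spaces -/

/-- The first point of the pair `M_w` in `M_T`. -/
noncomputable def a (w : W) : D.MT :=
  let p : D.X (.inr w) := Θ.pt₀ w
  D.toMT (.inr w) p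

/-- The second point of the pair `M_w` in `M_T`. -/
noncomputable def b (w : W) : D.MT :=
  let p : D.X (.inr w) := Θ.pt₁ w
  D.toMT (.inr w) p

/-- The distance of the two points of `M_w`. -/
noncomputable def len (w : W) : ℝ := dist (D.a w) (D.b w)

theorem len_nonneg (w : W) : 0 ≤ D.len w := dist_nonneg

theorem a_mem {S : Set (V ⊕ W)} {w : W} (hw : Sum.inr w ∈ S) : D.a w ∈ D.sub S :=
  ⟨_, hw, _, rfl⟩

theorem b_mem {S : Set (V ⊕ W)} {w : W} (hw : Sum.inr w ∈ S) : D.b w ∈ D.sub S :=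
  ⟨_, hw, _, rfl⟩

theorem a_mem_of_adj {S : Set (V ⊕ W)} {v : V} {w : W} (h : Θ.T.Adj (.inl v) (.inr w))
    (hv : Sum.inl v ∈ S) : D.a w ∈ D.sub S := ⟨_, hv, _, D.toMT_i h _⟩

theorem b_mem_of_adj {S : Set (V ⊕ W)} {v : V} {w : W} (h : Θ.T.Adj (.inl v) (.inr w))
    (hv : Sum.inl v ∈ S) : D.b w ∈ D.sub S := ⟨_, hv, _, D.toMT_i h _⟩

theorem a_mem_of_periph {F : Θ.FinSubtree} {w : W} (hw : w ∈ F.periph) :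
    D.a w ∈ D.sub F.verts := by
  obtain ⟨v, h, hv⟩ := hw
  by_cases hm : Sum.inr w ∈ F.verts
  · exact D.a_mem hm
  · exact D.a_mem_of_adj h (by tauto)

theorem b_mem_of_periph {F : Θ.FinSubtree} {w : W} (hw : w ∈ F.periph) :
    D.b w ∈ D.sub F.verts := by
  obtain ⟨v, h, hv⟩ := hw
  by_cases hm : Sum.inr w ∈ F.verts
  · exact D.b_mem hm
  · exact D.b_mem_of_adj h (by tauto)

/-- The vertex spaces of the star of spaces that defines the kettlebell space of `F`: the centre
`M_F` with the metric inherited from `M_T`, and, for every member `{a, b}` of the peripheral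
collection, the peripheral arc `[0, d(a, b)]`. -/
def KX (F : Θ.FinSubtree) : Option (ULift.{u} F.periph) → Type u
  | none => D.sub F.verts
  | some w => ULift.{u} (Icc (0 : ℝ) (D.len w.down))

noncomputable instance (F : Θ.FinSubtree) :
    (c : Option (ULift.{u} F.periph)) → PseudoEMetricSpace (D.KX F c)
  | none => inferInstanceAs (PseudoEMetricSpace (D.sub F.verts))
  | some w => inferInstanceAs (PseudoEMetricSpace (ULift.{u} (Icc (0 : ℝ) (D.len w.down))))

/-- The ends of the peripheral arc of `{a, b}` are glued to `a` and `b`. -/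
inductive KRel (F : Θ.FinSubtree) : (Σ c, D.KX F c) → (Σ c, D.KX F c) → Prop
  | left (w : ULift.{u} F.periph) : KRel F
      ⟨some w, ULift.up ⟨0, le_refl _, D.len_nonneg _⟩⟩
      ⟨none, ⟨D.a w.down, D.a_mem_of_periph w.down.2⟩⟩
  | right (w : ULift.{u} F.periph) : KRel F
      ⟨some w, ULift.up ⟨D.len w.down, D.len_nonneg _, le_refl _⟩⟩
      ⟨none, ⟨D.b w.down, D.b_mem_of_periph w.down.2⟩⟩

/-- The kettlebell space `M_F^*`. -/
def Kettle (F : Θ.FinSubtree) : Type u := Glue (D.KX F) (D.KRel F)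

noncomputable instance (F : Θ.FinSubtree) : PseudoEMetricSpace (D.Kettle F) :=
  inferInstanceAs (PseudoEMetricSpace (Glue (D.KX F) (D.KRel F)))

/-- The inclusion of `M_F` into the kettlebell space. -/
def base (F : Θ.FinSubtree) (x : D.MT) (hx : x ∈ D.sub F.verts) : D.Kettle F :=
  Glue.mk (D.KRel F) none ⟨x, hx⟩

/-- The peripheral arc of `M_w` in the kettlebell space. -/
def arc (F : Θ.FinSubtree) (w : W) (hw : w ∈ F.periph) (t : Icc (0 : ℝ) (D.len w)) :
    D.Kettle F :=
  Glue.mk (D.KRel F) (some (ULift.up ⟨w, hw⟩)) (ULift.up t)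

theorem arc_left (F : Θ.FinSubtree) (w : W) (hw : w ∈ F.periph) :
    D.arc F w hw ⟨0, le_refl _, D.len_nonneg _⟩ =
      D.base F (D.a w) (D.a_mem_of_periph hw) :=
  Quot.sound (KRel.left (ULift.up ⟨w, hw⟩))

theorem arc_right (F : Θ.FinSubtree) (w : W) (hw : w ∈ F.periph) :
    D.arc F w hw ⟨D.len w, D.len_nonneg _, le_refl _⟩ =
      D.base F (D.b w) (D.b_mem_of_periph hw) :=
  Quot.sound (KRel.right (ULift.up ⟨w, hw⟩))


theorem mem_sub_of_mem {S : Set (V ⊕ W)} {u : V ⊕ W} (hu : u ∈ S) (p : D.X u) :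
    D.toMT u p ∈ D.sub S := ⟨u, hu, p, rfl⟩

/-- An auxiliary function on the kettlebell space: the distance to `z` on `M_F`, interpolated
linearly on the peripheral arcs. -/
noncomputable def interp (F : Θ.FinSubtree) (z : D.MT) :
    (s : Σ c, D.KX F c) → ℝ
  | ⟨none, x⟩ => dist x.1 z
  | ⟨some w, t⟩ => dist (D.a w.down) z +
      t.down.1 / D.len w.down * (dist (D.b w.down) z - dist (D.a w.down) z)

theorem abs_dist_sub_le_len (w : W) (z : D.MT) :
    |dist (D.b w) z - dist (D.a w) z| ≤ D.len w := by
  rw [len, dist_comm (D.a w) (D.b w)]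
  exact abs_dist_sub_le (D.b w) (D.a w) z

/-- The function `interp` on the kettlebell space. -/
noncomputable def interpK (F : Θ.FinSubtree) (z : D.MT) : D.Kettle F → ℝ :=
  Quot.lift (D.interp F z) (by
    intro s t h
    cases h with
    | left w => simp [interp]
    | right w =>
      have h := D.abs_dist_sub_le_len w.down z
      by_cases h0 : D.len w.down = 0
      · rw [h0] at h
        have h' := abs_nonpos_iff.1 h
        simp only [interp, h', h0]
        linarith
      · simp [interp, div_self h0])

theorem abs_interpK_mk_le (F : Θ.FinSubtree) (z : D.MT) (c) (p q : D.KX F c) :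
    ENNReal.ofReal |D.interpK F z (Glue.mk (D.KRel F) c p) -
      D.interpK F z (Glue.mk (D.KRel F) c q)| ≤ edist p q := by
  cases c with
  | none =>
    have : edist p q = edist p.1 q.1 := rfl
    rw [this, edist_dist]
    exact ENNReal.ofReal_le_ofReal (abs_dist_sub_le p.1 q.1 z)
  | some w =>
    have : edist p q = edist p.down.1 q.down.1 := rfl
    rw [this, edist_dist]
    refine ENNReal.ofReal_le_ofReal ?_
    have h := D.abs_dist_sub_le_len w.down z
    change |dist (D.a w.down) z + p.down.1 / D.len w.down * (dist (D.b w.down) z -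
      dist (D.a w.down) z) - (dist (D.a w.down) z + q.down.1 / D.len w.down *
      (dist (D.b w.down) z - dist (D.a w.down) z))| ≤ _
    rw [Real.dist_eq, add_sub_add_left_eq_sub, ← sub_mul, ← sub_div, abs_mul, abs_div,
      abs_of_nonneg (D.len_nonneg w.down), div_mul_eq_mul_div]
    exact div_le_of_le_mul₀ (D.len_nonneg _) (abs_nonneg _)
      (mul_le_mul_of_nonneg_left h (abs_nonneg _))

theorem abs_interpK_le (F : Θ.FinSubtree) (z : D.MT) (x y : D.Kettle F) :
    ENNReal.ofReal |D.interpK F z x - D.interpK F z y| ≤ edist x y := by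
  refine le_sInf fun c hc => ?_
  induction hc with
  | single i p q => exact D.abs_interpK_mk_le F z i p q
  | cons i p q _ ih =>
    refine le_trans ?_ (add_le_add (D.abs_interpK_mk_le F z i p q) ih)
    rw [← ENNReal.ofReal_add (abs_nonneg _) (abs_nonneg _)]
    exact ENNReal.ofReal_le_ofReal (abs_sub_le _ _ _)

/-- The metric of the kettlebell space extends the metric of `M_F`. -/
theorem edist_base (F : Θ.FinSubtree) (x y : D.MT) (hx : x ∈ D.sub F.verts)
    (hy : y ∈ D.sub F.verts) : edist (D.base F x hx) (D.base F y hy) = edist x y := by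
  refine le_antisymm ((Glue.edist_mk_le (X := D.KX F) none ⟨x, hx⟩ ⟨y, hy⟩).trans
    (le_of_eq rfl)) ?_
  refine le_trans (le_of_eq ?_) (D.abs_interpK_le F y (D.base F x hx) (D.base F y hy))
  change edist x y = ENNReal.ofReal |dist x y - dist y y|
  rw [dist_self, sub_zero, abs_of_nonneg dist_nonneg, edist_dist]

/-! ### Bonding maps -/

/-- The function `u(x) = d(x, a) / (d(x, a) + d(x, b)) · d(a, b)` on the kettlebell space, with
values in `[0, d(a, b)]`, for the pair `{a, b} = M_w`. -/
noncomputable def collapse (F : Θ.FinSubtree) (w : W) (hw : Sum.inr w ∈ F.verts)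
    (x : D.Kettle F) : Icc (0 : ℝ) (D.len w) :=
  let s := (edist x (D.base F (D.a w) (D.a_mem hw))).toReal
  let t := (edist x (D.base F (D.b w) (D.b_mem hw))).toReal
  ⟨s / (s + t) * D.len w,
    mul_nonneg (div_nonneg ENNReal.toReal_nonneg
      (add_nonneg ENNReal.toReal_nonneg ENNReal.toReal_nonneg)) (D.len_nonneg w),
    mul_le_of_le_one_left (D.len_nonneg w)
      (div_le_one_of_le₀ (le_add_of_nonneg_right ENNReal.toReal_nonneg)
        (add_nonneg ENNReal.toReal_nonneg ENNReal.toReal_nonneg))⟩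

theorem collapse_a (F : Θ.FinSubtree) (w : W) (hw : Sum.inr w ∈ F.verts) :
    D.collapse F w hw (D.base F (D.a w) (D.a_mem hw)) =
      ⟨0, le_refl _, D.len_nonneg _⟩ := by
  apply Subtype.ext
  simp [collapse]

theorem collapse_b (F : Θ.FinSubtree) (w : W) (hw : Sum.inr w ∈ F.verts) :
    D.collapse F w hw (D.base F (D.b w) (D.b_mem hw)) =
      ⟨D.len w, D.len_nonneg _, le_refl _⟩ := by
  apply Subtype.ext
  have h : (edist (D.base F (D.b w) (D.b_mem hw))
      (D.base F (D.a w) (D.a_mem hw))).toReal = D.len w := by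
    rw [edist_base, edist_comm, edist_dist, ENNReal.toReal_ofReal dist_nonneg, len]
  by_cases h0 : D.len w = 0
  · simp [collapse, h0]
  · simp [collapse, h, div_self h0]

theorem eq_a_or_b {w : W} {x : D.MT} (hx : x ∈ D.sub {.inr w}) : x = D.a w ∨ x = D.b w := by
  obtain ⟨u, hu, p, rfl⟩ := hx
  rw [mem_singleton_iff] at hu
  subst hu
  have h : (p : Θ.M (.inr w)) ∈ (univ : Set (Θ.M (.inr w))) := mem_univ _
  rw [← (Θ.exists_pair w).choose_spec.choose_spec.2] at h
  rcases h with h | h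
  · exact Or.inl (congrArg _ h)
  · exact Or.inr (congrArg _ h)

/-- `M_v ∩ M_F ⊆ M_w` if `v ∉ F` is adjacent to `w ∈ F`. -/
theorem mem_sub_pair (F : Θ.FinSubtree) {v : V} {w : W} (h : Θ.T.Adj (.inl v) (.inr w))
    (hv : Sum.inl v ∉ F.verts) (hw : Sum.inr w ∈ F.verts) {x : D.MT}
    (hx : x ∈ D.sub {.inl v}) (hxF : x ∈ D.sub F.verts) : x ∈ D.sub {.inr w} := by
  set G := Θ.T.deleteEdges {s(Sum.inl v, Sum.inr w)} with hG
  have hbridge : ¬ G.Reachable (.inl v) (.inr w) :=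
    SimpleGraph.isAcyclic_iff_forall_adj_isBridge.1 Θ.isTree.isAcyclic h
  let P : D.MT → Prop := Quot.lift
    (fun s => G.Reachable (.inl v) s.1 ∨ D.toMT s.1 s.2 ∈ D.sub {.inr w}) (by
      intro s t hst
      cases hst with
      | @edge v' w' h' y =>
        rw [← D.toMT_i h' y]
        by_cases he : v' = v ∧ w' = w
        · obtain ⟨rfl, rfl⟩ := he
          have : D.toMT (.inr w') y ∈ D.sub {.inr w'} := D.mem_sub_of_mem (mem_singleton _) y
          simp [this]
        · have ha : G.Adj (.inl v') (.inr w') := by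
            rw [hG, SimpleGraph.deleteEdges_adj]
            refine ⟨h', ?_⟩
            simpa using he
          have : G.Reachable (.inl v) (.inr w') ↔ G.Reachable (.inl v) (.inl v') :=
            ⟨fun r => r.trans ha.symm.reachable, fun r => r.trans ha.reachable⟩
          simp only [this])
  have hP : P x := by
    obtain ⟨u, hu, p, rfl⟩ := hx
    rw [mem_singleton_iff] at hu
    subst hu
    exact Or.inl (SimpleGraph.Reachable.refl _)
  obtain ⟨u, hu, p, rfl⟩ := hxF
  rcases hP with hP | hP
  · refine absurd (hP.trans ?_) hbridge
    let φ : Θ.T.induce F.verts →g G :=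
      { toFun := Subtype.val
        map_rel' := by
          intro c d hcd
          rw [hG, SimpleGraph.deleteEdges_adj]
          refine ⟨hcd, fun he => hv ?_⟩
          rw [mem_singleton_iff, Sym2.eq_iff] at he
          rcases he with ⟨he, -⟩ | ⟨-, he⟩
          · exact he ▸ c.2
          · exact he ▸ d.2 }
    exact (F.connected.preconnected ⟨u, hu⟩ ⟨_, hw⟩).map φ
  · exact hP

theorem periph_of_augments {F F' : Θ.FinSubtree} {v : V} {w : W} (h : F.Augments F' v w)
    {w' : W} (hw' : w' ∈ F'.periph) (hn : w' ∉ F.periph) :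
    Sum.inl v ∉ F.verts ∧ Sum.inr w ∈ F.verts ∧ Θ.T.Adj (.inl v) (.inr w') := by
  have hne : w' ≠ w := fun he => hn (he ▸ h.mem_periph)
  obtain ⟨v₁, ha, hx⟩ := hw'
  have hx' : Sum.inl v₁ ∈ F.verts ↔ Sum.inr w' ∈ F.verts := by
    by_contra hc
    exact hn ⟨v₁, ha, hc⟩
  have he := h.exactly_one
  rw [h.verts_eq] at hx
  by_cases hv : v₁ = v
  · subst hv
    simp [hne] at hx
    tauto
  · simp [hne, hv] at hx
    tauto

theorem inr_mem_of_augments {F F' : Θ.FinSubtree} {v : V} {w : W} (h : F.Augments F' v w) :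
    Sum.inr w ∈ F'.verts := by
  rw [h.verts_eq]
  exact Or.inr (Or.inr rfl)

theorem arc_collapse_base {F F' : Θ.FinSubtree} {v : V} {w : W} (h : F.Augments F' v w)
    (hv : Sum.inl v ∉ F.verts) (hw : Sum.inr w ∈ F.verts) {x : D.MT}
    (hxv : x ∈ D.sub {.inl v}) (hxF : x ∈ D.sub F.verts) (hxF' : x ∈ D.sub F'.verts) :
    D.arc F w h.mem_periph (D.collapse F' w (inr_mem_of_augments h) (D.base F' x hxF')) =
      D.base F x hxF := by
  rcases D.eq_a_or_b (D.mem_sub_pair F h.adj hv hw hxv hxF) with hx | hx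
  · subst hx
    rw [D.collapse_a, D.arc_left]
  · subst hx
    rw [D.collapse_b, D.arc_right]

open Classical in
/-- The bonding map `M_{F'}^* → M_F^*` for `F' = F ∪ e`, `e = (v, w) ∈ N_F`, before passing to the
quotient: points of `M_F` and of peripheral arcs that belong to `M_F^*` are fixed; all other points
(they exist only if `v ∉ F`, and belong to `M_v` or to peripheral arcs attached to `M_v`) are
mapped by `u` to the peripheral arc of `M_F^*` corresponding to `e`. -/
noncomputable def bondAux {F F' : Θ.FinSubtree} {v : V} {w : W} (h : F.Augments F' v w) :
    (Σ c, D.KX F' c) → D.Kettle F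
  | ⟨none, x⟩ =>
    if hx : x.1 ∈ D.sub F.verts then D.base F x.1 hx
    else D.arc F w h.mem_periph
      (D.collapse F' w (inr_mem_of_augments h) (D.base F' x.1 x.2))
  | ⟨some w', t⟩ =>
    if hw' : w'.down.1 ∈ F.periph then D.arc F w'.down.1 hw' t.down
    else D.arc F w h.mem_periph
      (D.collapse F' w (inr_mem_of_augments h) (D.arc F' w'.down.1 w'.down.2 t.down))

/-- The bonding map `f_{F'F} : M_{F'}^* → M_F^*` if `F'` augments `F`. -/
noncomputable def bond {F F' : Θ.FinSubtree} {v : V} {w : W} (h : F.Augments F' v w) :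
    D.Kettle F' → D.Kettle F :=
  Quot.lift (D.bondAux h) (by
    intro s t hst
    cases hst with
    | left w' =>
      by_cases hw' : w'.down.1 ∈ F.periph
      · have ha : D.a w'.down.1 ∈ D.sub F.verts := D.a_mem_of_periph hw'
        simp only [bondAux, dif_pos hw', dif_pos ha]
        exact D.arc_left F w'.down.1 hw'
      · obtain ⟨h1, h2, h3⟩ := periph_of_augments h w'.down.2 hw'
        have hl := D.arc_left F' w'.down.1 w'.down.2
        simp only [bondAux, dif_neg hw']
        rw [hl]
        split_ifs with hx
        · exact D.arc_collapse_base h h1 h2 (D.a_mem_of_adj h3 rfl) hx _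
        · rfl
    | right w' =>
      by_cases hw' : w'.down.1 ∈ F.periph
      · have hb : D.b w'.down.1 ∈ D.sub F.verts := D.b_mem_of_periph hw'
        simp only [bondAux, dif_pos hw', dif_pos hb]
        exact D.arc_right F w'.down.1 hw'
      · obtain ⟨h1, h2, h3⟩ := periph_of_augments h w'.down.2 hw'
        have hl := D.arc_right F' w'.down.1 w'.down.2
        simp only [bondAux, dif_neg hw']
        rw [hl]
        split_ifs with hx
        · exact D.arc_collapse_base h h1 h2 (D.b_mem_of_adj h3 rfl) hx _
        · rfl)

/-- `IsBonding F F' f`: the map `f : M_{F'}^* → M_F^*` is a bonding map of the inverse system, the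
composition of the bonding maps along an augmenting chain from `F` to `F'`. -/
inductive IsBonding : ∀ F F' : Θ.FinSubtree, (D.Kettle F' → D.Kettle F) → Prop
  | refl (F : Θ.FinSubtree) : IsBonding F F id
  | step {F F₁ F' : Θ.FinSubtree} {g : D.Kettle F₁ → D.Kettle F} {v : V} {w : W}
      (hg : IsBonding F F₁ g) (h : F₁.Augments F' v w) : IsBonding F F' (g ∘ D.bond h)

/-- The inverse limit `M_Θ` of the kettlebell spaces, a subspace of their product. -/
def MΘ : Type u :=
  {x : ∀ F : Θ.FinSubtree, D.Kettle F //
    ∀ (F F' : Θ.FinSubtree) (f : D.Kettle F' → D.Kettle F), D.IsBonding F F' f →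
      f (x F') = x F}

instance : TopologicalSpace D.MΘ := inferInstanceAs (TopologicalSpace (Subtype _))

/-- `γ` is the natural map `M_T → M_Θ`: for `F ⊆ F'` and `x ∈ M_{F'}` the coordinate of `γ x`
at `F` is `f_{F'F} x`. -/
def IsNaturalMap (γ : D.MT → D.MΘ) : Prop :=
  ∀ (F F' : Θ.FinSubtree) (f : D.Kettle F' → D.Kettle F), D.IsBonding F F' f →
    ∀ (x : D.MT) (hx : x ∈ D.sub F'.verts), (γ x).1 F = f (D.base F' x hx)

end CompatibleMetrics

end TreeSystem

/-!
The key tool is that functions on `M_T` can be tested on the vertex spaces: a function which is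
`1`-Lipschitz on every vertex space is `1`-Lipschitz for the quotient metric. Extending a
`1`-Lipschitz function from one vertex space to the others, edge by edge along the tree, shows that
the vertex spaces are isometrically embedded (`dist_toMT`). A function that is pieced together from
two sides of a vertex `w` shows that the distance of points on different sides is attained by a path
through one of the two points of `M_w` (`exists_dist_eq_add`); hence the quotient pseudometric is a
metric (`eq_of_dist_eq_zero`).

Going down the tree from `v₀`, the diameters of the vertex spaces behind `w` are bounded by
`len w` as well as by a geometric series in the depth. By dominated convergence the branch behind
`w` is small if `len w` is (`exists_len_bound`), and only finitely many pairs are long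
(`finite_len_ge`). So for every `ε` the subspace `M_F` is `ε`-dense in `M_T` for all large enough
finite subtrees `F`, and the peripheral pairs of `F` have length at most `ε`
(`exists_finite_dense`). This gives total boundedness.

Kettlebell spaces are compact metric spaces. The map `s / (s + t) * L` on a space with two marked
points at distance `L`, with `s` and `t` the distances to these points, is `1`-Lipschitz as
`s + t ≥ L`. Therefore all bonding maps are `1`-Lipschitz (`edist_bond_le`). They do not depend on
the augmenting chain, since the bonding maps for two different edges at `F` commute
(`bond_bond_comm`, `IsBonding.unique`); this makes the natural map `γ` well defined. Its coordinate
at `F` is `1`-Lipschitz on `M_T` and isometric on `M_F`, so if `M_F` is `ε`-dense, then it changes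
distances by at most `4 * ε`. Consequently the extension of `γ` to the completion is injective; it
is surjective by compactness, since points of `M_F^*` are close to points of `M_F` for large `F`
(`exists_homeomorph`).

Finally, the vertex spaces along a ray converge to a point of the completion, because the branches
that the ray enters become small. A point outside of `M_T` determines a ray, as at every vertex it
lies in the closure of one of the finitely many branches that are not close to that vertex
(`exists_childOf_mem_closure`). Since the closures of the two sides of `w` meet in `M_w` only
(`mem_csub_of_mem_closure`), inequivalent rays have different limits outside of `M_T`, and the end
of a ray that converges to a point of `M_T` is redundant.
-/

/-! ### Rooted trees -/

namespace SimpleGraph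

variable {α : Type*} {G : SimpleGraph α}

/-- In the graph `G` rooted at `r`, the vertex `t` is a child of `s`: it is adjacent to `s` and
one step further away from the root. -/
def ChildOf (G : SimpleGraph α) (r s t : α) : Prop :=
  G.Adj s t ∧ G.dist r t = G.dist r s + 1

/-- In the graph `G` rooted at `r`, the vertex `t` is a descendant of `s` (possibly `s` itself). -/
def Below (G : SimpleGraph α) (r : α) : α → α → Prop :=
  Relation.ReflTransGen (G.ChildOf r)

theorem IsTree.childOf_or_childOf (hG : G.IsTree) (r : α) {s t : α} (h : G.Adj s t) :
    G.ChildOf r s t ∨ G.ChildOf r t s := by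
  rcases hG.dist_eq_dist_add_one_of_adj r h with h' | h'
  · exact Or.inr ⟨h.symm, h'⟩
  · exact Or.inl ⟨h, h'⟩

theorem ChildOf.dist_pos {r s t : α} (h : G.ChildOf r s t) : 0 < G.dist r t := by
  rw [h.2]; omega

theorem ChildOf.ne_root {r s t : α} (h : G.ChildOf r s t) : t ≠ r := by
  rintro rfl
  simpa using h.dist_pos

/-- Parents in a rooted tree are unique. -/
theorem IsTree.eq_of_childOf (hG : G.IsTree) {r s s' t : α} (h : G.ChildOf r s t)
    (h' : G.ChildOf r s' t) : s = s' := by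
  obtain ⟨p, -, hp⟩ := hG.connected.exists_path_of_dist r s
  obtain ⟨p', -, hp'⟩ := hG.connected.exists_path_of_dist r s'
  have hq : (p.concat h.1).IsPath :=
    Walk.isPath_of_length_eq_dist _ (by rw [Walk.length_concat, hp, h.2])
  have hq' : (p'.concat h'.1).IsPath :=
    Walk.isPath_of_length_eq_dist _ (by rw [Walk.length_concat, hp', h'.2])
  have h0 := (hG.existsUnique_path r t).unique hq hq'
  have := congrArg Walk.penultimate h0
  simpa using this

theorem IsTree.exists_childOf (hG : G.IsTree) {r t : α} (h : t ≠ r) : ∃ s, G.ChildOf r s t := by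
  obtain ⟨p, hp, hl⟩ := hG.connected.exists_path_of_dist r t
  have hn : ¬ p.Nil := fun hn => h hn.eq.symm
  have ha := p.adj_penultimate hn
  refine ⟨_, ha, ?_⟩
  rcases hG.dist_eq_dist_add_one_of_adj r ha with h' | h'
  · have h1 := SimpleGraph.dist_le p.dropLast
    have h2 : p.dropLast.length + 1 = p.length := Walk.length_dropLast_add_one hn
    omega
  · exact h'

theorem IsTree.below_root (hG : G.IsTree) (r t : α) : G.Below r r t := by
  induction hn : G.dist r t generalizing t with
  | zero =>
    rw [hG.connected.dist_eq_zero_iff] at hn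
    subst hn
    exact .refl
  | succ n ih =>
    have : t ≠ r := by rintro rfl; simp at hn
    obtain ⟨s, hs⟩ := hG.exists_childOf this
    have h2 := hs.2
    exact (ih s (by omega)).tail hs

theorem Below.dist_le {r s t : α} (h : G.Below r s t) : G.dist r s ≤ G.dist r t := by
  induction h with
  | refl => exact le_rfl
  | tail _ h ih => rw [h.2]; omega

theorem ChildOf.not_below {r s t : α} (h : G.ChildOf r s t) : ¬ G.Below r t s := fun h' => by
  have := h'.dist_le
  have := h.2
  omega

/-- The parent of a proper descendant of `s` is a descendant of `s`. -/
theorem IsTree.below_of_childOf (hG : G.IsTree) {r s t t' : α} (h : G.Below r s t')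
    (hc : G.ChildOf r t t') (hne : t' ≠ s) : G.Below r s t := by
  cases h with
  | refl => exact absurd rfl hne
  | tail h1 h2 => rwa [hG.eq_of_childOf hc h2]

/-- The only edge between the descendants of `s` and the other vertices is the edge between `s`
and its parent. -/
theorem IsTree.eq_of_adj_of_below (hG : G.IsTree) {r s t t' : α} (h : G.Adj t t')
    (ht : G.Below r s t) (ht' : ¬ G.Below r s t') : t = s ∧ G.ChildOf r t' s := by
  rcases hG.childOf_or_childOf r h with hc | hc
  · exact absurd (ht.tail hc) ht'
  · by_cases hne : t = s
    · exact ⟨hne, hne ▸ hc⟩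
    · exact absurd (hG.below_of_childOf ht hc hne) ht'

/-- Descending from a vertex of `F` to a vertex outside of `F`, one leaves `F` somewhere. -/
theorem Below.exists_exit {r s t : α} (h : G.Below r s t) {F : Set α} (hs : s ∈ F)
    (ht : t ∉ F) : ∃ y x, G.ChildOf r y x ∧ y ∈ F ∧ x ∉ F ∧ G.Below r x t := by
  induction h with
  | refl => exact absurd hs ht
  | @tail y x h1 h2 ih =>
    by_cases hy : y ∈ F
    · exact ⟨y, x, h2, hy, ht, .refl⟩
    · obtain ⟨y', x', h3, h4, h5, h6⟩ := ih hy
      exact ⟨y', x', h3, h4, h5, h6.tail h2⟩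

/-- A connected set of vertices that contains the root and not the child `v` of the root contains
no descendant of `v`. -/
theorem IsTree.not_below_of_connected (hG : G.IsTree) {r v : α} (hv : G.Adj r v) {F : Set α}
    (hF : (G.induce F).Connected) (hr : r ∈ F) (hvF : v ∉ F) {t : α} (ht : t ∈ F) :
    ¬ G.Below r v t := by
  obtain ⟨p⟩ := hF.preconnected ⟨r, hr⟩ ⟨t, ht⟩
  have key : ∀ (x y : F) (p : (G.induce F).Walk x y), ¬ G.Below r v x → ¬ G.Below r v y := by
    intro x y p
    induction p with
    | nil => exact id
    | @cons x y z h _ ih =>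
      refine fun hx => ih fun hy => ?_
      exact hvF ((hG.eq_of_adj_of_below (SimpleGraph.Adj.symm h) hy hx).1 ▸ y.2)
  refine key _ _ p ?_
  have : G.ChildOf r r v := ⟨hv, by simp [SimpleGraph.dist_eq_one_iff_adj.2 hv]⟩
  exact this.not_below

/-- Data on the vertices of a tree can be chosen, starting with prescribed data at the root, such
that a relation holds along all edges, if this can be achieved along every single edge. -/
theorem IsTree.exists_extension (hG : G.IsTree) (r : α) {Y : α → Type*}
    (R : ∀ a b, Y a → Y b → Prop) (hR : ∀ a b, G.Adj a b → ∀ y : Y a, ∃ y' : Y b, R a b y y')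
    (y₀ : Y r) : ∃ f : ∀ a, Y a, f r = y₀ ∧ ∀ a b, G.ChildOf r a b → R a b (f a) (f b) := by
  classical
  choose par hpar using fun (t : α) (ht : t ≠ r) => hG.exists_childOf (r := r) ht
  choose nxt hnxt using hR
  let wf : WellFounded (fun s t : α => G.dist r s < G.dist r t) :=
    (measure (fun t => G.dist r t)).wf
  let step : ∀ t : α, (∀ s : α, G.dist r s < G.dist r t → Y s) → Y t := fun t rec =>
    if h : t = r then h ▸ y₀ else
      nxt (par t h) t (hpar t h).1 (rec (par t h) (by have := (hpar t h).2; omega))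
  refine ⟨fun t => wf.fix step t, ?_, ?_⟩
  · change wf.fix step r = y₀
    rw [wf.fix_eq]
    simp [step]
  · intro a b hab
    have hb : b ≠ r := hab.ne_root
    have h1 : wf.fix step b = nxt (par b hb) b (hpar b hb).1 (wf.fix step (par b hb)) := by
      rw [wf.fix_eq]
      simp [step, hb]
    have h2 : par b hb = a := hG.eq_of_childOf (hpar b hb) hab
    change R a b (wf.fix step a) (wf.fix step b)
    rw [h1]
    have := hnxt (par b hb) b (hpar b hb).1 (wf.fix step (par b hb))
    subst h2
    exact this

end SimpleGraph

/-! ### Functions on glued spaces -/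

namespace Glue

variable {ι : Type u} {X : ι → Type u} {r : (Σ i, X i) → (Σ i, X i) → Prop}
  [∀ i, PseudoEMetricSpace (X i)]

/-- A map on a glued space is `1`-Lipschitz if it is so on every piece. -/
theorem edist_map_le {Y : Type*} [PseudoEMetricSpace Y] (f : Glue X r → Y)
    (hf : ∀ i (p q : X i), edist (f (mk r i p)) (f (mk r i q)) ≤ edist p q) (x y : Glue X r) :
    edist (f x) (f y) ≤ edist x y := by
  refine le_sInf fun c hc => ?_
  induction hc with
  | single i p q => exact hf i p q
  | cons i p q _ ih => exact (edist_triangle _ _ _).trans (add_le_add (hf i p q) ih)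

end Glue

/-! ### The metric of the total space -/

namespace TreeSystem.CompatibleMetrics

variable {V W : Type u} {Θ : TreeSystem V W} (D : Θ.CompatibleMetrics)

theorem dist_toMT_le (u : V ⊕ W) (p q : D.X u) : dist (D.toMT u p) (D.toMT u q) ≤ dist p q := by
  have h : edist (D.toMT u p) (D.toMT u q) ≤ edist p q := Glue.edist_mk_le u p q
  rw [edist_dist, edist_dist] at h
  exact (ENNReal.ofReal_le_ofReal_iff dist_nonneg).1 h

theorem exists_toMT (x : D.MT) : ∃ u p, x = D.toMT u p := by
  induction x using Glue.ind with
  | h u p => exact ⟨u, p, rfl⟩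

theorem mem_sub_singleton {u : V ⊕ W} {x : D.MT} :
    x ∈ D.sub {u} ↔ ∃ p, x = D.toMT u p := by
  constructor
  · rintro ⟨u', h, p, rfl⟩
    rw [mem_singleton_iff] at h
    subst h
    exact ⟨p, rfl⟩
  · rintro ⟨p, rfl⟩
    exact ⟨u, rfl, p, rfl⟩

theorem sub_mono {S S' : Set (V ⊕ W)} (h : S ⊆ S') : D.sub S ⊆ D.sub S' := by
  rintro x ⟨u, hu, p, rfl⟩
  exact ⟨u, h hu, p, rfl⟩

theorem mem_sub_iff {S : Set (V ⊕ W)} {x : D.MT} : x ∈ D.sub S ↔ ∃ u ∈ S, x ∈ D.sub {u} := by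
  constructor
  · rintro ⟨u, hu, p, rfl⟩
    exact ⟨u, hu, u, rfl, p, rfl⟩
  · rintro ⟨u, hu, hx⟩
    exact D.sub_mono (singleton_subset_iff.2 hu) hx

theorem a_mem_sub (w : W) : D.a w ∈ D.sub {.inr w} := D.a_mem rfl

theorem b_mem_sub (w : W) : D.b w ∈ D.sub {.inr w} := D.b_mem rfl

/-- The pair `M_w` is contained in `M_v` for every neighbour `v` of `w`. -/
theorem sub_inr_subset {v : V} {w : W} (h : Θ.T.Adj (.inl v) (.inr w)) :
    D.sub {.inr w} ⊆ D.sub {.inl v} := by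
  intro x hx
  obtain ⟨p, rfl⟩ := D.mem_sub_singleton.1 hx
  rw [D.toMT_i h]
  exact D.mem_sub_singleton.2 ⟨_, rfl⟩

/-- A function on `M_T` given by compatible functions on the vertex spaces. -/
def lift {β : Type*} (f : ∀ u, D.X u → β)
    (h : ∀ {v : V} {w : W} (h : Θ.T.Adj (.inl v) (.inr w)) (x : D.X (.inr w)),
      f (.inr w) x = f (.inl v) (D.i h x)) : D.MT → β :=
  Quot.lift (fun s => f s.1 s.2) (by
    rintro _ _ ⟨hvw, x⟩
    exact h hvw x)

theorem abs_sub_le_dist (f : D.MT → ℝ)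
    (hf : ∀ u (p q : D.X u), |f (D.toMT u p) - f (D.toMT u q)| ≤ dist p q) (x y : D.MT) :
    |f x - f y| ≤ dist x y := by
  have h : edist (f x) (f y) ≤ edist x y := by
    refine Glue.edist_map_le (X := D.X) (r := D.Rel) f (fun u p q => ?_) x y
    rw [edist_dist, edist_dist, Real.dist_eq]
    exact ENNReal.ofReal_le_ofReal (hf u p q)
  rw [edist_dist, edist_dist, Real.dist_eq] at h
  exact (ENNReal.ofReal_le_ofReal_iff dist_nonneg).1 h

/-- Compatibility of functions on two vertex spaces, for the vertices of an edge. -/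
def Agree : ∀ u u' : V ⊕ W, {g : D.X u → ℝ // LipschitzWith 1 g} →
    {g : D.X u' → ℝ // LipschitzWith 1 g} → Prop
  | .inl v, .inr w, g, g' =>
    ∀ (h : Θ.T.Adj (.inl v) (.inr w)) (x : D.X (.inr w)), g'.1 x = g.1 (D.i h x)
  | .inr w, .inl v, g, g' =>
    ∀ (h : Θ.T.Adj (.inl v) (.inr w)) (x : D.X (.inr w)), g.1 x = g'.1 (D.i h x)
  | .inl _, .inl _, _, _ => True
  | .inr _, .inr _, _, _ => True

theorem dist_i_eq {v : V} {w : W} (h : Θ.T.Adj (.inl v) (.inr w)) (x y : D.X (.inr w)) :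
    dist (D.i h x) (D.i h y) = dist x y := D.dist_i h x y

theorem exists_agree (u u' : V ⊕ W) (h : Θ.T.Adj u u') (g : {g : D.X u → ℝ // LipschitzWith 1 g}) :
    ∃ g', D.Agree u u' g g' := by
  rcases u with v | w <;> rcases u' with v' | w'
  · exact absurd h (Θ.not_adj_inl _ _)
  · refine ⟨⟨fun x => g.1 (D.i h x), LipschitzWith.of_dist_le_mul fun x y => ?_⟩, fun h x => rfl⟩
    rw [← D.dist_i_eq h]
    exact g.2.dist_le_mul _ _
  · have hi : Function.Injective (D.i h.symm) := Θ.i_injective h.symm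
    obtain ⟨x₀⟩ : Nonempty (D.X (.inr w)) := ⟨Θ.pt₀ w⟩
    have : Nonempty (D.X (.inr w)) := ⟨x₀⟩
    have hl : LipschitzOnWith 1 (g.1 ∘ Function.invFun (D.i h.symm)) (range (D.i h.symm)) := by
      refine LipschitzOnWith.of_dist_le_mul ?_
      rintro _ ⟨x, rfl⟩ _ ⟨y, rfl⟩
      simp only [Function.comp, Function.leftInverse_invFun hi _]
      rw [D.dist_i_eq]
      exact g.2.dist_le_mul _ _
    obtain ⟨g', h1, h2⟩ := hl.extend_real
    refine ⟨⟨g', h1⟩, fun _ x => ?_⟩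
    have := h2 (mem_range_self x)
    simp only [Function.comp, Function.leftInverse_invFun hi _] at this
    exact this
  · exact absurd h (Θ.not_adj_inr _ _)

/-- The vertex spaces are isometrically embedded in `M_T`: a `1`-Lipschitz function on a vertex
space extends to `M_T`, piece by piece along the tree. -/
theorem dist_toMT (u : V ⊕ W) (p q : D.X u) : dist (D.toMT u p) (D.toMT u q) = dist p q := by
  refine le_antisymm (D.dist_toMT_le u p q) ?_
  obtain ⟨f, hf, hR⟩ := Θ.isTree.exists_extension u (Y := fun u' =>
    {g : D.X u' → ℝ // LipschitzWith 1 g}) (fun a b => D.Agree a b)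
    (fun a b h y => D.exists_agree a b h y) ⟨fun x => dist x q, LipschitzWith.dist_left q⟩
  let F : D.MT → ℝ := D.lift (fun u p => (f u).1 p) (by
    intro v w h x
    rcases Θ.isTree.childOf_or_childOf u h with hc | hc
    · exact hR _ _ hc h x
    · exact hR _ _ hc h x)
  have := D.abs_sub_le_dist F (fun u p q => by
    have := (f u).2.dist_le_mul p q
    rw [Real.dist_eq, NNReal.coe_one, one_mul] at this
    exact this) (D.toMT u p) (D.toMT u q)
  refine le_trans ?_ this
  change dist p q ≤ |(f u).1 p - (f u).1 q|
  rw [hf]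
  simp

/-- If a set `S` of vertices is separated from its complement by the vertex `w`, then the pair
`M_w` separates `M_S` metrically from the union of the other vertex spaces: the distance is
attained by passing through a point of `M_w`. -/
theorem exists_dist_eq_add {S : Set (V ⊕ W)} {w : W}
    (hS : ∀ t ∈ S, ∀ t' ∉ S, Θ.T.Adj t t' → t = .inr w ∨ t' = .inr w) {x y : D.MT}
    (hx : x ∈ D.sub S) (hy : y ∈ D.sub Sᶜ) :
    ∃ c ∈ D.sub {.inr w}, dist x y = dist x c + dist c y := by
  classical
  let A : D.MT → ℝ := fun z => dist x z
  let B : D.MT → ℝ := fun z =>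
    min (dist x (D.a w) + dist (D.a w) z) (dist x (D.b w) + dist (D.b w) z)
  have hA : ∀ z z', |A z - A z'| ≤ dist z z' := fun z z' => by
    simp only [A]
    rw [dist_comm x z, dist_comm x z']
    exact abs_dist_sub_le z z' x
  have hB : ∀ z z', |B z - B z'| ≤ dist z z' := fun z z' => by
    refine (abs_min_sub_min_le_max _ _ _ _).trans ?_
    rw [add_sub_add_left_eq_sub, add_sub_add_left_eq_sub, dist_comm _ z, dist_comm _ z',
      dist_comm _ z, dist_comm _ z']
    exact max_le (abs_dist_sub_le _ _ _) (abs_dist_sub_le _ _ _)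
  have hAB : ∀ z ∈ D.sub {.inr w}, A z = B z := by
    intro z hz
    have h1 := dist_triangle x (D.a w) z
    have h2 := dist_triangle x (D.b w) z
    refine le_antisymm (le_min h1 h2) ?_
    rcases D.eq_a_or_b hz with rfl | rfl
    · exact (min_le_left _ _).trans (by simp [A])
    · exact (min_le_right _ _).trans (by simp [A])
  let F : D.MT → ℝ := D.lift (fun u p => if u ∈ S then A (D.toMT u p) else B (D.toMT u p)) (by
    intro v w' h p
    rw [← D.toMT_i h p]
    have key : (.inr w' ∈ S ↔ .inl v ∈ S) ∨ w' = w := by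
      by_cases h1 : (.inr w' : V ⊕ W) ∈ S <;> by_cases h2 : (.inl v : V ⊕ W) ∈ S
      · exact Or.inl (iff_of_true h1 h2)
      · have := hS _ h1 _ h2 h.symm
        simp at this
        exact Or.inr this
      · have := hS _ h2 _ h1 h
        simp at this
        exact Or.inr this
      · exact Or.inl (iff_of_false h1 h2)
    rcases key with key | rfl
    · simp only [key]
    · rw [hAB _ (D.mem_sub_singleton.2 ⟨p, rfl⟩), ite_self, ite_self])
  have hF := D.abs_sub_le_dist F (fun u p q => by
    refine le_trans ?_ (D.dist_toMT_le u p q)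
    change |(if u ∈ S then A (D.toMT u p) else B (D.toMT u p)) -
      (if u ∈ S then A (D.toMT u q) else B (D.toMT u q))| ≤ _
    split_ifs
    · exact hA _ _
    · exact hB _ _) y x
  have hFx : F x = 0 := by
    obtain ⟨u, hu, p, rfl⟩ := hx
    change (if u ∈ S then A (D.toMT u p) else B (D.toMT u p)) = 0
    rw [if_pos hu]
    exact dist_self _
  have hFy : F y = B y := by
    obtain ⟨u, hu, p, rfl⟩ := hy
    change (if u ∈ S then A (D.toMT u p) else B (D.toMT u p)) = _
    rw [if_neg hu]
  rw [hFx, hFy, sub_zero, dist_comm y x] at hF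
  have h3 := (le_abs_self _).trans hF
  rcases min_le_iff.1 h3 with h | h
  · exact ⟨_, D.a_mem_sub w, le_antisymm (dist_triangle _ _ _) h⟩
  · exact ⟨_, D.b_mem_sub w, le_antisymm (dist_triangle _ _ _) h⟩

/-- The quotient pseudometric on `M_T` is a metric. -/
theorem eq_of_dist_eq_zero {x y : D.MT} (h : dist x y = 0) : x = y := by
  obtain ⟨u, p, rfl⟩ := D.exists_toMT x
  obtain ⟨t, q, rfl⟩ := D.exists_toMT y
  have hut := Θ.isTree.below_root u t
  induction hut with
  | refl => rw [D.dist_toMT] at h; rw [dist_eq_zero.1 h]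
  | @tail s t hs hst ih =>
    rcases s with v | w <;> rcases t with v' | w'
    · exact absurd hst.1 (Θ.not_adj_inl _ _)
    · rw [D.toMT_i hst.1] at h ⊢
      exact ih _ h
    · have hmem : D.toMT u p ∈ D.sub {t | Θ.T.Below u (.inl v') t}ᶜ :=
        ⟨u, fun hb => hst.ne_root (by
          have h1 := SimpleGraph.Below.dist_le hb
          have h2 := hst.dist_pos
          rw [SimpleGraph.dist_self] at h1
          omega), p, rfl⟩
      obtain ⟨c, hc, hd⟩ := D.exists_dist_eq_add (S := {t | Θ.T.Below u (.inl v') t}) (w := w)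
        (fun t ht t' ht' ha => by
          have := (Θ.isTree.eq_of_adj_of_below ha ht ht').2
          exact Or.inr (Θ.isTree.eq_of_childOf this hst))
        (D.mem_sub_of_mem (u := .inl v') .refl q) hmem
      rw [dist_comm, h] at hd
      obtain ⟨c, rfl⟩ := D.mem_sub_singleton.1 hc
      obtain ⟨h1, h2⟩ := (add_eq_zero_iff_of_nonneg dist_nonneg dist_nonneg).1 hd.symm
      rw [dist_comm] at h2
      rw [D.toMT_i hst.1.symm, D.dist_toMT, dist_eq_zero] at h1
      rw [h1, ← D.toMT_i hst.1.symm]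
      exact ih _ h2
    · exact absurd hst.1 (Θ.not_adj_inr _ _)

end TreeSystem.CompatibleMetrics

/-! ### Shrinking: branches behind short pairs are small -/

namespace TreeSystem

variable {V W : Type u}

/-- A non-empty finite set of vertices is contained in a finite subtree. -/
theorem exists_finSubtree (Θ : TreeSystem V W) {B : Set (V ⊕ W)} (hB : B.Finite)
    (hne : B.Nonempty) : ∃ F : Θ.FinSubtree, B ⊆ F.verts := by
  obtain ⟨t', h1, h2⟩ := SimpleGraph.extend_finset_to_connected
    Θ.isTree.connected.preconnected (t := hB.toFinset) (by simpa using hne)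
  exact ⟨⟨t', t'.finite_toSet, h2⟩, fun x hx => h1 (by simpa using hx)⟩

/-- The vertices in `V` are those at an even distance from `v₀`. -/
theorem even_dist_iff (Θ : TreeSystem V W) (v₀ : V) (t : V ⊕ W) :
    Even (Θ.T.dist (.inl v₀) t) ↔ t.isLeft := by
  have := Θ.isTree.below_root (.inl v₀) t
  induction this with
  | refl => simp
  | @tail s t hs hst ih =>
    have hst' := hst.2
    rw [hst', Nat.even_add_one]
    refine (not_congr ih).trans ?_
    rcases s with v | w <;> rcases t with v' | w'
    · exact absurd hst.1 (Θ.not_adj_inl _ _)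
    · simp
    · simp
    · exact absurd hst.1 (Θ.not_adj_inr _ _)

namespace CompatibleMetrics

variable {Θ : TreeSystem V W} (D : Θ.CompatibleMetrics)

instance (v : V) : CompactSpace (D.X (.inl v)) := by
  have h := Θ.compact v
  rw [← D.top_eq v] at h
  exact h

instance (w : W) : Finite (D.X (.inr w)) :=
  Nat.finite_of_card_ne_zero (α := Θ.M (.inr w)) (by rw [Θ.card_pair w]; decide)

instance (u : V ⊕ W) : CompactSpace (D.X u) := by
  rcases u with v | w
  · infer_instance
  · infer_instance

theorem continuous_toMT (u : V ⊕ W) : Continuous (D.toMT u) :=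
  (Isometry.of_dist_eq (D.dist_toMT u)).continuous

theorem isCompact_sub_singleton (u : V ⊕ W) : IsCompact (D.sub {u}) := by
  have : D.sub {u} = range (D.toMT u) := by
    ext x
    rw [D.mem_sub_singleton]
    exact ⟨fun ⟨p, h⟩ => ⟨p, h.symm⟩, fun ⟨p, h⟩ => ⟨p, h.symm⟩⟩
  rw [this]
  exact isCompact_range (D.continuous_toMT u)

theorem isCompact_sub {S : Set (V ⊕ W)} (hS : S.Finite) : IsCompact (D.sub S) := by
  have : D.sub S = ⋃ u ∈ S, D.sub {u} := by
    ext x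
    rw [D.mem_sub_iff]
    simp
  rw [this]
  exact hS.isCompact_biUnion fun u _ => D.isCompact_sub_singleton u

theorem dist_le_len {w : W} {x y : D.MT} (hx : x ∈ D.sub {.inr w}) (hy : y ∈ D.sub {.inr w}) :
    dist x y ≤ D.len w := by
  have := D.len_nonneg w
  rcases D.eq_a_or_b hx with rfl | rfl <;> rcases D.eq_a_or_b hy with rfl | rfl
  · rwa [dist_self]
  · exact le_rfl
  · rw [dist_comm]; exact le_rfl
  · rwa [dist_self]

theorem exists_a_b_eq (w : W) : ∃ p q : D.X (.inr w), p ≠ q ∧ D.a w = D.toMT _ p ∧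
    D.b w = D.toMT _ q :=
  ⟨Θ.pt₀ w, Θ.pt₁ w, (Θ.exists_pair w).choose_spec.choose_spec.1, rfl, rfl⟩

theorem len_pos (w : W) : 0 < D.len w := by
  obtain ⟨p, q, hne, hp, hq⟩ := D.exists_a_b_eq w
  rw [len, hp, hq, D.dist_toMT]
  exact dist_pos.2 hne

/-- Only finitely many of the pairs in one vertex space are long. -/
theorem finite_adj_len_ge (v : V) {δ : ℝ} (hδ : 0 < δ) :
    {w | Θ.T.Adj (.inl v) (.inr w) ∧ δ ≤ D.len w}.Finite := by
  classical
  have hfin := Θ.null v (D.met (.inl v)) (D.top_eq v) δ hδ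
  let f : W → Set (Θ.M (.inl v)) := fun w =>
    if h : Θ.T.Adj (.inl v) (.inr w) then range (Θ.i h) else ∅
  refine Set.Finite.of_injOn (f := f) ?_ ?_ hfin
  · rintro w ⟨h, hw⟩
    simp only [f, dif_pos h]
    refine ⟨⟨w, h, rfl⟩, hw.trans ?_⟩
    have hb : Bornology.IsBounded (range (D.i h)) := (finite_range (D.i h)).isBounded
    obtain ⟨p, q, -, hp, hq⟩ := D.exists_a_b_eq w
    have h1 := Metric.dist_le_diam_of_mem hb (mem_range_self p) (mem_range_self q)
    rw [D.dist_i_eq, ← D.dist_toMT, ← hp, ← hq] at h1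
    exact h1
  · rintro w ⟨h, -⟩ w' ⟨h', -⟩ he
    by_contra hne
    simp only [f, dif_pos h, dif_pos h'] at he
    have hs := Θ.inter_subsingleton h h' hne
    rw [← he, inter_self] at hs
    exact (Θ.exists_pair w).choose_spec.choose_spec.1
      (Θ.i_injective h (hs (mem_range_self (Θ.pt₀ w)) (mem_range_self (Θ.pt₁ w))))

namespace IsShrinking

variable {D} {v₀ : V} (hD : D.IsShrinking v₀)

include hD

/-- The vertex spaces shrink exponentially with the distance from `v₀`. -/
theorem dist_le_pow {u : V ⊕ W} {x y : D.MT} (hx : x ∈ D.sub {u}) (hy : y ∈ D.sub {u}) :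
    dist x y ≤ 2 * (3 / 4) ^ Θ.T.dist (.inl v₀) u := by
  -- `(1 / 2) ^ k ≤ (3 / 4) ^ (2 * k)`; the factor `2` allows for vertices at odd distance
  have key : ∀ v : V, ∀ x ∈ D.sub {.inl v}, ∀ y ∈ D.sub {.inl v},
      dist x y ≤ (3 / 4) ^ Θ.T.dist (.inl v₀) (.inl v) := by
    intro v x hx y hy
    obtain ⟨k, hk⟩ := (Θ.even_dist_iff v₀ (.inl v)).2 rfl
    rw [← two_mul] at hk
    refine (Metric.dist_le_diam_of_mem (D.isCompact_sub_singleton _).isBounded hx hy).trans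
      ((hD.diam_le v k hk).trans ?_)
    rw [hk, pow_mul]
    gcongr
    norm_num
  rcases u with v | w
  · refine (key v x hx y hy).trans ?_
    have : (0 : ℝ) ≤ (3 / 4) ^ Θ.T.dist (.inl v₀) (.inl v) := by positivity
    linarith
  · obtain ⟨s, hs⟩ := Θ.isTree.exists_childOf (r := .inl v₀) (t := .inr w) (by simp)
    rcases s with v | w'
    · refine (key v x (D.sub_inr_subset hs.1 hx) y (D.sub_inr_subset hs.1 hy)).trans ?_
      rw [hs.2, pow_succ]
      have : (0 : ℝ) ≤ (3 / 4) ^ Θ.T.dist (.inl v₀) (.inl v) := by positivity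
      linarith
    · exact absurd hs.1 (Θ.not_adj_inr _ _)

theorem len_le_pow (w : W) : D.len w ≤ 2 * (3 / 4) ^ Θ.T.dist (.inl v₀) (.inr w) :=
  hD.dist_le_pow (D.a_mem_sub w) (D.b_mem_sub w)

/-- The space of a child `v` of `w` has the diameter of the pair `M_w`. -/
theorem dist_le_len_of_childOf {v : V} {w : W} (h : Θ.T.ChildOf (.inl v₀) (.inr w) (.inl v))
    {x y : D.MT} (hx : x ∈ D.sub {.inl v}) (hy : y ∈ D.sub {.inl v}) : dist x y ≤ D.len w := by
  refine (Metric.dist_le_diam_of_mem (D.isCompact_sub_singleton _).isBounded hx hy).trans ?_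
  rw [hD.diam_eq v w h.1.symm (by rw [h.2]; omega)]
  exact Metric.diam_le_of_forall_dist_le (D.len_nonneg w) fun x hx y hy => D.dist_le_len hx hy

theorem dist_le_len_of_below {w : W} {t : V ⊕ W} (h : Θ.T.Below (.inl v₀) (.inr w) t)
    {x y : D.MT} (hx : x ∈ D.sub {t}) (hy : y ∈ D.sub {t}) : dist x y ≤ D.len w := by
  induction h generalizing x y with
  | refl => exact D.dist_le_len hx hy
  | @tail s t hs hst ih =>
    rcases s with v | w' <;> rcases t with v' | w''
    · exact absurd hst.1 (Θ.not_adj_inl _ _)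
    · exact ih (D.sub_inr_subset hst.1 hx) (D.sub_inr_subset hst.1 hy)
    · exact (hD.dist_le_len_of_childOf hst hx hy).trans (ih (D.a_mem_sub w') (D.b_mem_sub w'))
    · exact absurd hst.1 (Θ.not_adj_inr _ _)

/-- Going down the tree from `w`, the distances to `M_w` add up to at most a partial sum of a
series all of whose terms are bounded by the length of `M_w` and by those of a geometric series. -/
theorem dist_a_le_sum {w : W} {t : V ⊕ W} (h : Θ.T.Below (.inl v₀) (.inr w) t) {y : D.MT}
    (hy : y ∈ D.sub {t}) : dist y (D.a w) ≤
      ∑ m ∈ Finset.range (Θ.T.dist (.inl v₀) t + 1), min (D.len w) (2 * (3 / 4) ^ m) := by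
  have hnn : ∀ m : ℕ, 0 ≤ min (D.len w) (2 * (3 / 4 : ℝ) ^ m) := fun m =>
    le_min (D.len_nonneg w) (by positivity)
  have step : ∀ {s : V ⊕ W} {x y : D.MT}, Θ.T.Below (.inl v₀) (.inr w) s → x ∈ D.sub {s} →
      y ∈ D.sub {s} → dist x y ≤ min (D.len w) (2 * (3 / 4) ^ Θ.T.dist (.inl v₀) s) :=
    fun hs hx hy => le_min (hD.dist_le_len_of_below hs hx hy) (hD.dist_le_pow hx hy)
  induction h generalizing y with
  | refl =>
    rw [Finset.sum_range_succ]
    have := step .refl hy (D.a_mem_sub w)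
    have h2 := Finset.sum_nonneg fun m (_ : m ∈ Finset.range (Θ.T.dist (.inl v₀) (.inr w))) => hnn m
    linarith
  | @tail s t hs hst ih =>
    rw [Finset.sum_range_succ, hst.2]
    rcases s with v | w' <;> rcases t with v' | w''
    · exact absurd hst.1 (Θ.not_adj_inl _ _)
    · have := ih (D.sub_inr_subset hst.1 hy)
      have h2 := hnn (Θ.T.dist (.inl v₀) (.inl v) + 1)
      linarith
    · have h1 := ih (D.a_mem_sub w')
      have h2 := step (hs.tail hst) hy (D.sub_inr_subset hst.1.symm (D.a_mem_sub w'))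
      rw [hst.2] at h2
      have h3 := dist_triangle y (D.a w') (D.a w)
      linarith
    · exact absurd hst.1 (Θ.not_adj_inr _ _)

/-- The branches behind short pairs are small. -/
theorem exists_len_bound {ε : ℝ} (hε : 0 < ε) : ∃ δ > 0, ∀ w, D.len w < δ →
    ∀ t, Θ.T.Below (.inl v₀) (.inr w) t → ∀ y ∈ D.sub {t}, dist y (D.a w) ≤ ε := by
  have hsum : Summable fun m : ℕ => 2 * (3 / 4 : ℝ) ^ m :=
    (summable_geometric_of_lt_one (by norm_num) (by norm_num)).mul_left 2
  have hnn : ∀ (l : ℝ) (m : ℕ), 0 ≤ min |l| (2 * (3 / 4 : ℝ) ^ m) := fun l m =>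
    le_min (abs_nonneg l) (by positivity)
  have hlim : Tendsto (fun l : ℝ => ∑' m : ℕ, min |l| (2 * (3 / 4 : ℝ) ^ m)) (𝓝 0) (𝓝 0) := by
    have := tendsto_tsum_of_dominated_convergence (𝓕 := 𝓝 (0 : ℝ))
      (f := fun (l : ℝ) (m : ℕ) => min |l| (2 * (3 / 4 : ℝ) ^ m)) (g := fun _ => (0 : ℝ))
      hsum (fun m => by
        have hc : Continuous fun l : ℝ => min |l| (2 * (3 / 4 : ℝ) ^ m) := by fun_prop
        have h0 := hc.tendsto 0
        rwa [abs_zero, min_eq_left (by positivity)] at h0)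
      (Eventually.of_forall fun l m => by
        rw [Real.norm_of_nonneg (hnn l m)]
        exact min_le_right _ _)
    simpa using this
  obtain ⟨δ, hδ, h⟩ := Metric.eventually_nhds_iff.1 (hlim.eventually (gt_mem_nhds hε))
  refine ⟨δ, hδ, fun w hw t ht y hy => (hD.dist_a_le_sum ht hy).trans ?_⟩
  have hl := @h (D.len w) (by rwa [Real.dist_eq, sub_zero, abs_of_nonneg (D.len_nonneg w)])
  refine le_trans ?_ hl.le
  have hs : Summable fun m : ℕ => min |D.len w| (2 * (3 / 4 : ℝ) ^ m) :=
    hsum.of_nonneg_of_le (hnn _) fun m => min_le_right _ _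
  have := hs.sum_le_tsum (Finset.range (Θ.T.dist (.inl v₀) t + 1)) (fun m _ => hnn _ m)
  rwa [abs_of_nonneg (D.len_nonneg w)] at this ⊢

/-- Only finitely many pairs are long. -/
theorem finite_len_ge {δ : ℝ} (hδ : 0 < δ) : {w | δ ≤ D.len w}.Finite := by
  have key : ∀ n : ℕ, {w | Θ.T.dist (.inl v₀) (.inr w) ≤ n ∧ δ ≤ D.len w}.Finite := by
    intro n
    induction n with
    | zero =>
      refine Set.finite_empty.subset ?_
      rintro w ⟨h, -⟩
      rw [Nat.le_zero, Θ.isTree.connected.dist_eq_zero_iff] at h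
      simp at h
    | succ n ih =>
      have hB : (insert v₀ (⋃ w ∈ {w | Θ.T.dist (.inl v₀) (.inr w) ≤ n ∧ δ ≤ D.len w},
          {v | Sum.inl v ∈ Θ.T.neighborSet (.inr w)})).Finite := by
        refine (Set.Finite.biUnion ih fun w _ => ?_).insert _
        exact (Θ.finite_valence w).preimage Sum.inl_injective.injOn
      refine (Set.Finite.biUnion hB fun v _ => D.finite_adj_len_ge v hδ).subset ?_
      rintro w ⟨h, hw⟩
      obtain ⟨s, hs⟩ := Θ.isTree.exists_childOf (r := .inl v₀) (t := .inr w) (by simp)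
      rcases s with v | w'
      · refine mem_biUnion (x := v) ?_ ⟨hs.1, hw⟩
        by_cases hv : v = v₀
        · exact Or.inl hv
        · right
          obtain ⟨s', hs'⟩ := Θ.isTree.exists_childOf (r := .inl v₀) (t := .inl v) (by simpa)
          rcases s' with v' | w'
          · exact absurd hs'.1 (Θ.not_adj_inl _ _)
          · have h1 := hs.2
            have h2 := hs'.2
            refine mem_biUnion (x := w') ⟨by omega, hw.trans ?_⟩ hs'.1
            exact hD.dist_le_len_of_childOf hs' (D.sub_inr_subset hs.1 (D.a_mem_sub w))
              (D.sub_inr_subset hs.1 (D.b_mem_sub w))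
      · exact absurd hs.1 (Θ.not_adj_inr _ _)
  obtain ⟨n, hn⟩ := exists_pow_lt_of_lt_one (half_pos hδ) (by norm_num : (3 / 4 : ℝ) < 1)
  refine (key n).subset fun w hw => ⟨?_, hw⟩
  by_contra hlt
  have h1 := hD.len_le_pow w
  have h2 : (3 / 4 : ℝ) ^ Θ.T.dist (.inl v₀) (.inr w) ≤ (3 / 4) ^ n :=
    pow_le_pow_of_le_one (by norm_num) (by norm_num) (by omega)
  have : δ ≤ D.len w := hw
  linarith

/-- For a large enough finite subtree `F`, the space `M_F` is almost dense in `M_T`, and the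
peripheral pairs of `F` are short. -/
theorem exists_finite_dense {ε : ℝ} (hε : 0 < ε) : ∃ B : Set (V ⊕ W), B.Finite ∧ B.Nonempty ∧
    ∀ F : Θ.FinSubtree, B ⊆ F.verts →
      (∀ x : D.MT, ∃ y ∈ D.sub F.verts, dist x y ≤ ε) ∧ ∀ w ∈ F.periph, D.len w ≤ ε := by
  obtain ⟨δ, hδ, hb⟩ := hD.exists_len_bound hε
  have hfin := hD.finite_len_ge (lt_min hδ hε)
  set bad := {w | min δ ε ≤ D.len w} with hbad
  refine ⟨insert (.inl v₀) (Sum.inr '' bad ∪ ⋃ w ∈ bad, Θ.T.neighborSet (.inr w)),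
    ((hfin.image _).union (hfin.biUnion fun w _ => Θ.finite_valence w)).insert _,
    insert_nonempty _ _, fun F hF => ?_⟩
  have hgood : ∀ v w, Θ.T.Adj (.inl v) (.inr w) →
      ¬ (Sum.inl v ∈ F.verts ↔ Sum.inr w ∈ F.verts) → D.len w < min δ ε := by
    intro v w h hn
    by_contra hw
    have hw' : w ∈ bad := not_lt.1 hw
    exact hn (iff_of_true (hF (Or.inr (Or.inr (mem_biUnion hw' h.symm))))
      (hF (Or.inr (Or.inl ⟨w, hw', rfl⟩))))
  refine ⟨fun x => ?_, fun w ⟨v, h, hn⟩ => (hgood v w h hn).le.trans (min_le_right _ _)⟩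
  obtain ⟨t, p, rfl⟩ := D.exists_toMT x
  by_cases ht : t ∈ F.verts
  · exact ⟨_, D.mem_sub_of_mem ht p, by rw [dist_self]; exact hε.le⟩
  · obtain ⟨y, x, hyx, hy, hx, hxt⟩ := (Θ.isTree.below_root (.inl v₀) t).exists_exit
      (hF (mem_insert _ _)) ht
    rcases y with v | w <;> rcases x with v' | w'
    · exact absurd hyx.1 (Θ.not_adj_inl _ _)
    · refine ⟨D.a w', D.a_mem_of_adj hyx.1 hy, hb w' ?_ t hxt _
        (D.mem_sub_of_mem (mem_singleton t) p)⟩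
      exact (hgood v w' hyx.1 (by tauto)).trans_le (min_le_left _ _)
    · refine ⟨D.a w, D.a_mem hy, hb w ?_ t (.head hyx hxt) _ (D.mem_sub_of_mem (mem_singleton t) p)⟩
      exact (hgood v' w hyx.1.symm (by tauto)).trans_le (min_le_left _ _)
    · exact absurd hyx.1 (Θ.not_adj_inr _ _)

theorem exists_finSubtree_dense {ε : ℝ} (hε : 0 < ε) : ∃ F : Θ.FinSubtree,
    ∀ x : D.MT, ∃ y ∈ D.sub F.verts, dist x y ≤ ε := by
  obtain ⟨B, h1, h2, h3⟩ := hD.exists_finite_dense hε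
  obtain ⟨F, hF⟩ := Θ.exists_finSubtree h1 h2
  exact ⟨F, (h3 F hF).1⟩

theorem totallyBounded : TotallyBounded (univ : Set D.MT) := by
  rw [Metric.totallyBounded_iff]
  intro ε hε
  obtain ⟨F, hF⟩ := hD.exists_finSubtree_dense (half_pos hε)
  obtain ⟨t, ht, hcov⟩ := Metric.totallyBounded_iff.1
    (D.isCompact_sub F.finite).totallyBounded (ε / 2) (half_pos hε)
  refine ⟨t, ht, fun x _ => ?_⟩
  obtain ⟨y, hy, hxy⟩ := hF x
  obtain ⟨z, hz, hyz⟩ := mem_iUnion₂.1 (hcov hy)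
  refine mem_iUnion₂.2 ⟨z, hz, ?_⟩
  rw [Metric.mem_ball] at hyz ⊢
  have := dist_triangle x y z
  linarith

end IsShrinking

end CompatibleMetrics

end TreeSystem

/-! ### Kettlebell spaces -/

namespace TreeSystem.CompatibleMetrics

variable {V W : Type u} {Θ : TreeSystem V W} (D : Θ.CompatibleMetrics) (F : Θ.FinSubtree)

theorem exists_base_or_arc (y : D.Kettle F) :
    (∃ x hx, y = D.base F x hx) ∨ ∃ w hw t, y = D.arc F w hw t := by
  induction y using Glue.ind with
  | h c p =>
    rcases c with _ | ⟨⟨w, hw⟩⟩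
    · exact Or.inl ⟨p.1, p.2, rfl⟩
    · exact Or.inr ⟨w, hw, p.down, rfl⟩

theorem edist_arc_le {w : W} (hw : w ∈ F.periph) (t t' : Icc (0 : ℝ) (D.len w)) :
    edist (D.arc F w hw t) (D.arc F w hw t') ≤ edist t.1 t'.1 :=
  Glue.edist_mk_le (X := D.KX F) (r := D.KRel F) (some (ULift.up ⟨w, hw⟩)) (ULift.up t)
    (ULift.up t')

/-- A map on a kettlebell space is `1`-Lipschitz if it is so on `M_F` and on the peripheral
arcs. -/
theorem edist_map_le {Y : Type*} [PseudoEMetricSpace Y] (f : D.Kettle F → Y)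
    (h₁ : ∀ x hx y hy, edist (f (D.base F x hx)) (f (D.base F y hy)) ≤ edist x y)
    (h₂ : ∀ w hw t t', edist (f (D.arc F w hw t)) (f (D.arc F w hw t')) ≤ edist t.1 t'.1)
    (x y : D.Kettle F) : edist (f x) (f y) ≤ edist x y := by
  refine Glue.edist_map_le (X := D.KX F) (r := D.KRel F) f (fun c p q => ?_) x y
  rcases c with _ | ⟨⟨w, hw⟩⟩
  · exact h₁ p.1 p.2 q.1 q.2
  · exact h₂ w hw p.down q.down

theorem edist_ne_top_kettle (x y : D.Kettle F) : edist x y ≠ ⊤ := by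
  have key : ∀ x : D.Kettle F, ∃ z hz, edist x (D.base F z hz) ≠ ⊤ := by
    intro x
    rcases D.exists_base_or_arc F x with ⟨z, hz, rfl⟩ | ⟨w, hw, t, rfl⟩
    · exact ⟨z, hz, by simp⟩
    · refine ⟨D.a w, D.a_mem_of_periph hw, ?_⟩
      rw [← D.arc_left F w hw]
      exact ne_top_of_le_ne_top (edist_ne_top _ _) (D.edist_arc_le F hw _ _)
  obtain ⟨z, hz, h⟩ := key x
  obtain ⟨z', hz', h'⟩ := key y
  refine ne_top_of_le_ne_top ?_ (edist_triangle4 x (D.base F z hz) (D.base F z' hz') y)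
  rw [edist_comm] at h'
  rw [D.edist_base]
  exact ENNReal.add_ne_top.2 ⟨ENNReal.add_ne_top.2 ⟨h, edist_ne_top _ _⟩, h'⟩

noncomputable instance : PseudoMetricSpace (D.Kettle F) :=
  PseudoEMetricSpace.toPseudoMetricSpace (D.edist_ne_top_kettle F)

theorem dist_base (x y : D.MT) (hx : x ∈ D.sub F.verts) (hy : y ∈ D.sub F.verts) :
    dist (D.base F x hx) (D.base F y hy) = dist x y := by
  rw [dist_edist, D.edist_base, ← dist_edist]

theorem dist_arc_le {w : W} (hw : w ∈ F.periph) (t t' : Icc (0 : ℝ) (D.len w)) :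
    dist (D.arc F w hw t) (D.arc F w hw t') ≤ |t.1 - t'.1| := by
  have := D.edist_arc_le F hw t t'
  rw [edist_dist, edist_dist] at this
  exact (ENNReal.ofReal_le_ofReal_iff dist_nonneg).1 this

theorem abs_sub_le_dist_kettle (f : D.Kettle F → ℝ)
    (h₁ : ∀ x hx y hy, |f (D.base F x hx) - f (D.base F y hy)| ≤ dist x y)
    (h₂ : ∀ w hw t t', |f (D.arc F w hw t) - f (D.arc F w hw t')| ≤ |t.1 - t'.1|)
    (x y : D.Kettle F) : |f x - f y| ≤ dist x y := by
  have h := D.edist_map_le F f (fun x hx y hy => by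
    rw [edist_dist, edist_dist]
    exact ENNReal.ofReal_le_ofReal (h₁ x hx y hy)) (fun w hw t t' => by
    rw [edist_dist, edist_dist]
    exact ENNReal.ofReal_le_ofReal (h₂ w hw t t')) x y
  rw [edist_dist, edist_dist, Real.dist_eq] at h
  exact (ENNReal.ofReal_le_ofReal_iff dist_nonneg).1 h

/-- A function on the kettlebell space given by compatible functions on `M_T` and on the
peripheral arcs. -/
def liftKettle {β : Type*} (g : D.MT → β) (h : W → ℝ → β) (h₀ : ∀ w, h w 0 = g (D.a w))
    (h₁ : ∀ w, h w (D.len w) = g (D.b w)) : D.Kettle F → β :=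
  Quot.lift (fun s => match s with
    | ⟨none, x⟩ => g x.1
    | ⟨some w, t⟩ => h w.down t.down.1) (by
    rintro _ _ (w | w)
    · exact h₀ _
    · exact h₁ _)

/-- A point of a peripheral arc is connected to `M_F` through one of the two ends of the arc. In
particular its distance to a point of `M_F` does not depend on `F`. -/
theorem dist_arc_base {w : W} (hw : w ∈ F.periph) (t : Icc (0 : ℝ) (D.len w)) {z : D.MT}
    (hz : z ∈ D.sub F.verts) : dist (D.arc F w hw t) (D.base F z hz) =
      min (t.1 + dist (D.a w) z) (D.len w - t.1 + dist (D.b w) z) := by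
  refine le_antisymm (le_min ?_ ?_) ?_
  · refine (dist_triangle _ (D.base F (D.a w) (D.a_mem_of_periph hw)) _).trans ?_
    rw [D.dist_base]
    refine add_le_add_left ?_ _
    rw [← D.arc_left F w hw]
    refine (D.dist_arc_le F hw _ _).trans ?_
    simp [abs_of_nonneg t.2.1]
  · refine (dist_triangle _ (D.base F (D.b w) (D.b_mem_of_periph hw)) _).trans ?_
    rw [D.dist_base]
    refine add_le_add_left ?_ _
    rw [← D.arc_right F w hw]
    refine (D.dist_arc_le F hw _ _).trans ?_
    rw [abs_sub_comm]
    exact (abs_of_nonneg (sub_nonneg.2 t.2.2)).le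
  · let f : D.Kettle F → ℝ := D.liftKettle F (fun x => dist x z)
      (fun w t => min (t + dist (D.a w) z) (D.len w - t + dist (D.b w) z))
      (fun w => by
        rw [zero_add, sub_zero]
        exact min_eq_left (dist_triangle _ _ _))
      (fun w => by
        rw [sub_self, zero_add]
        refine min_eq_right ?_
        rw [len, dist_comm (D.a w) (D.b w)]
        exact dist_triangle _ _ _)
    have h := D.abs_sub_le_dist_kettle F f (fun x hx y hy => abs_dist_sub_le _ _ _)
      (fun w hw t t' => by
        refine (abs_min_sub_min_le_max _ _ _ _).trans (max_le ?_ ?_)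
        · rw [add_sub_add_right_eq_sub]
        · rw [add_sub_add_right_eq_sub, sub_sub_sub_cancel_left, abs_sub_comm])
      (D.arc F w hw t) (D.base F z hz)
    refine le_trans ?_ h
    refine le_trans ?_ (le_abs_self _)
    change _ ≤ min (t.1 + dist (D.a w) z) (D.len w - t.1 + dist (D.b w) z) - dist z z
    rw [dist_self, sub_zero]

/-- The kettlebell space is a metric space. -/
theorem eq_of_dist_eq_zero_kettle {x y : D.Kettle F} (h : dist x y = 0) : x = y := by
  have hab : ∀ w hw (t : Icc (0 : ℝ) (D.len w)) z hz,
      dist (D.arc F w hw t) (D.base F z hz) = 0 → D.arc F w hw t = D.base F z hz := by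
    intro w hw t z hz h0
    rw [D.dist_arc_base] at h0
    rcases min_choice (t.1 + dist (D.a w) z) (D.len w - t.1 + dist (D.b w) z) with he | he
    · rw [he] at h0
      obtain ⟨h1, h2⟩ := (add_eq_zero_iff_of_nonneg t.2.1 dist_nonneg).1 h0
      have h3 := D.eq_of_dist_eq_zero h2
      subst h3
      rw [← D.arc_left F w hw]
      exact congrArg _ (Subtype.ext h1)
    · rw [he] at h0
      obtain ⟨h1, h2⟩ := (add_eq_zero_iff_of_nonneg (sub_nonneg.2 t.2.2) dist_nonneg).1 h0
      have h3 := D.eq_of_dist_eq_zero h2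
      subst h3
      rw [← D.arc_right F w hw]
      exact congrArg _ (Subtype.ext (sub_eq_zero.1 h1).symm)
  rcases D.exists_base_or_arc F x with ⟨x, hx, rfl⟩ | ⟨w, hw, t, rfl⟩ <;>
    rcases D.exists_base_or_arc F y with ⟨y, hy, rfl⟩ | ⟨w', hw', t', rfl⟩
  · rw [D.dist_base] at h
    have := D.eq_of_dist_eq_zero h
    subst this
    rfl
  · rw [dist_comm] at h
    exact (hab _ _ _ _ _ h).symm
  · exact hab _ _ _ _ _ h
  · by_cases hww : w = w'
    · -- on the arc of `w`, the function `interpK` for the point `a` is the arc parameter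
      subst hww
      have h1 := D.abs_interpK_le F (D.a w) (D.arc F w hw t) (D.arc F w hw t')
      rw [edist_dist, h, ENNReal.ofReal_zero, nonpos_iff_eq_zero, ENNReal.ofReal_eq_zero] at h1
      have h2 : ∀ t : Icc (0 : ℝ) (D.len w), D.interpK F (D.a w) (D.arc F w hw t) = t.1 := by
        intro t
        change dist (D.a w) (D.a w) + t.1 / D.len w * (dist (D.b w) (D.a w) -
          dist (D.a w) (D.a w)) = t.1
        have : dist (D.b w) (D.a w) = D.len w := dist_comm _ _
        rw [dist_self, zero_add, sub_zero, this, div_mul_cancel₀ _ (D.len_pos w).ne']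
      rw [h2, h2] at h1
      exact congrArg _ (Subtype.ext (sub_eq_zero.1 (abs_nonpos_iff.1 h1)))
    · -- a tent function on the arc of `w` shows that `t` is an end of the arc
      classical
      let f : D.Kettle F → ℝ := D.liftKettle F (fun _ => 0)
        (fun u s => if u = w then min s (D.len u - s) else 0)
        (fun u => by simp [D.len_nonneg u]) (fun u => by simp [D.len_nonneg u])
      have hf := D.abs_sub_le_dist_kettle F f
        (fun x hx y hy => by
          change |(0 : ℝ) - 0| ≤ dist x y
          simp)
        (fun u hu s s' => by
          change |(if u = w then min s.1 (D.len u - s.1) else 0) -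
            (if u = w then min s'.1 (D.len u - s'.1) else 0)| ≤ _
          split_ifs
          · refine (abs_min_sub_min_le_max _ _ _ _).trans (max_le le_rfl ?_)
            rw [sub_sub_sub_cancel_left, abs_sub_comm]
          · simp) (D.arc F w hw t) (D.arc F w' hw' t')
      rw [h] at hf
      have hf2 : f (D.arc F w hw t) - f (D.arc F w' hw' t') = min t.1 (D.len w - t.1) := by
        change (if w = w then min t.1 (D.len w - t.1) else 0) -
          (if w' = w then min t'.1 (D.len w' - t'.1) else 0) = _
        rw [if_pos rfl, if_neg (Ne.symm hww), sub_zero]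
      rw [hf2] at hf
      have hf3 := abs_nonpos_iff.1 hf
      have hbase : ∃ z hz, D.arc F w hw t = D.base F z hz := by
        rcases min_choice t.1 (D.len w - t.1) with he | he
        · refine ⟨_, D.a_mem_of_periph hw, ?_⟩
          rw [← D.arc_left F w hw]
          exact congrArg _ (Subtype.ext (he ▸ hf3))
        · refine ⟨_, D.b_mem_of_periph hw, ?_⟩
          rw [← D.arc_right F w hw]
          rw [he] at hf3
          exact congrArg _ (Subtype.ext (sub_eq_zero.1 hf3).symm)
      obtain ⟨z, hz, he⟩ := hbase
      rw [he, dist_comm] at h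
      rw [he]
      exact (hab _ _ _ _ _ h).symm

instance : T0Space (D.Kettle F) := by
  refine ⟨fun x y h => D.eq_of_dist_eq_zero_kettle F ?_⟩
  rw [← Metric.inseparable_iff]
  exact h

theorem continuous_arc {w : W} (hw : w ∈ F.periph) : Continuous (D.arc F w hw) :=
  (LipschitzWith.of_edist_le (D.edist_arc_le F hw)).continuous

theorem isCompact_range_base :
    IsCompact (range fun x : D.sub F.verts => D.base F x.1 x.2) := by
  have := isCompact_iff_compactSpace.1 (D.isCompact_sub F.finite)
  exact isCompact_range (Isometry.of_dist_eq (fun x y => D.dist_base F _ _ x.2 y.2)).continuous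

/-- The kettlebell spaces are compact, as their peripheral arcs form a null sequence. -/
theorem IsShrinking.compactSpace_kettle {D : Θ.CompatibleMetrics} {v₀ : V} (hD : D.IsShrinking v₀)
    (F : Θ.FinSubtree) : CompactSpace (D.Kettle F) := by
  refine ⟨isCompact_iff_ultrafilter_le_nhds.2 fun f _ => ?_⟩
  by_contra hcon
  have hcon : ∀ x, ¬ (f : Filter (D.Kettle F)) ≤ 𝓝 x := fun x hx => hcon ⟨x, mem_univ _, hx⟩
  have hK : ∀ K : Set (D.Kettle F), IsCompact K → K ∉ f := fun K hK hf => by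
    obtain ⟨x, -, hx⟩ := isCompact_iff_ultrafilter_le_nhds.1 hK f (le_principal_iff.2 hf)
    exact hcon x hx
  have hU : ∀ x, ∃ U : Set (D.Kettle F), IsOpen U ∧ x ∈ U ∧ U ∉ f := by
    intro x
    obtain ⟨s, hs, hsf⟩ := Filter.not_le.1 (hcon x)
    obtain ⟨U, hUs, hU, hx⟩ := mem_nhds_iff.1 hs
    exact ⟨U, hU, hx, fun h => hsf (mem_of_superset h hUs)⟩
  choose U hUo hxU hUf using hU
  obtain ⟨t, -, hcov⟩ := (D.isCompact_range_base F).elim_nhds_subcover U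
    (fun x _ => (hUo x).mem_nhds (hxU x))
  obtain ⟨δ, hδ, hthick⟩ := (D.isCompact_range_base F).exists_thickening_subset_open
    (isOpen_biUnion fun x (_ : x ∈ t) => hUo x) hcov
  have hfin := hD.finite_len_ge hδ
  have huniv : (⋃ x ∈ t, U x) ∪ ⋃ w ∈ {w | δ ≤ D.len w},
      {y | ∃ hw s, y = D.arc F w hw s} = univ := by
    refine eq_univ_of_forall fun y => ?_
    rcases D.exists_base_or_arc F y with ⟨x, hx, rfl⟩ | ⟨w, hw, s, rfl⟩
    · exact Or.inl (hcov ⟨⟨x, hx⟩, rfl⟩)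
    · by_cases hl : δ ≤ D.len w
      · exact Or.inr (mem_biUnion (x := w) hl ⟨hw, s, rfl⟩)
      · refine Or.inl (hthick (Metric.mem_thickening_iff.2
          ⟨_, ⟨⟨D.a w, D.a_mem_of_periph hw⟩, rfl⟩, ?_⟩))
        change dist _ (D.base F _ _) < _
        rw [← D.arc_left F w hw]
        refine (D.dist_arc_le F hw _ _).trans_lt ?_
        rw [sub_zero, abs_of_nonneg s.2.1]
        exact s.2.2.trans_lt (not_le.1 hl)
  have hmem : (⋃ x ∈ t, U x) ∪ ⋃ w ∈ {w | δ ≤ D.len w},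
      {y | ∃ hw s, y = D.arc F w hw s} ∈ f := huniv ▸ univ_mem
  rcases Ultrafilter.union_mem_iff.1 hmem with h | h
  · obtain ⟨x, -, hx⟩ := (Ultrafilter.finite_biUnion_mem_iff t.finite_toSet).1 h
    exact hUf x hx
  · obtain ⟨w, -, hw⟩ := (Ultrafilter.finite_biUnion_mem_iff hfin).1 h
    refine hK _ ?_ hw
    by_cases hp : w ∈ F.periph
    · have : {y | ∃ hw s, y = D.arc F w hw s} = range (D.arc F w hp) := by
        ext y
        exact ⟨fun ⟨_, s, h⟩ => ⟨s, h.symm⟩, fun ⟨s, h⟩ => ⟨hp, s, h.symm⟩⟩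
      rw [this]
      exact isCompact_range (D.continuous_arc F hp)
    · have : {y | ∃ hw s, y = D.arc F w hw s} = ∅ := by
        ext y
        simp [hp]
      rw [this]
      exact isCompact_empty

end TreeSystem.CompatibleMetrics

/-! ### Bonding maps are `1`-Lipschitz -/

namespace TreeSystem

variable {V W : Type u} {Θ : TreeSystem V W}

theorem FinSubtree.ext {F F' : Θ.FinSubtree} (h : F.verts = F'.verts) : F = F' := by
  cases F
  cases F'
  simp only at h
  subst h
  rfl

theorem FinSubtree.Augments.subset {F F' : Θ.FinSubtree} {v : V} {w : W}
    (h : F.Augments F' v w) : F.verts ⊆ F'.verts := by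
  rw [h.verts_eq]
  exact subset_union_left

namespace CompatibleMetrics

variable (D : Θ.CompatibleMetrics)

section Collapse

variable (F : Θ.FinSubtree) {w : W} (hw : Sum.inr w ∈ F.verts)

theorem collapse_val (x : D.Kettle F) : (D.collapse F w hw x).1 =
    dist x (D.base F (D.a w) (D.a_mem hw)) / (dist x (D.base F (D.a w) (D.a_mem hw)) +
      dist x (D.base F (D.b w) (D.b_mem hw))) * D.len w := by
  rw [dist_edist, dist_edist]
  rfl

/-- The map `s / (s + t) * L`, with `s` and `t` the distances to two points at distance `L`, is
`1`-Lipschitz since `s + t ≥ L`. -/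
theorem abs_collapse_sub_le (x y : D.Kettle F) :
    |(D.collapse F w hw x).1 - (D.collapse F w hw y).1| ≤ dist x y := by
  rw [D.collapse_val, D.collapse_val]
  set A := D.base F (D.a w) (D.a_mem hw)
  set B := D.base F (D.b w) (D.b_mem hw)
  have hL : dist A B = D.len w := D.dist_base F _ _ _ _
  have hL0 := D.len_pos w
  have h1 : D.len w ≤ dist x A + dist x B := by
    rw [← hL, dist_comm x A]
    exact dist_triangle _ _ _
  have h2 : D.len w ≤ dist y A + dist y B := by
    rw [← hL, dist_comm y A]
    exact dist_triangle _ _ _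
  have h3 := abs_dist_sub_le x y A
  have h4 := abs_dist_sub_le y x B
  rw [dist_comm y x] at h4
  have hs : 0 ≤ dist x A := dist_nonneg
  have ht : 0 ≤ dist x B := dist_nonneg
  generalize dist x A = s at *
  generalize dist x B = t at *
  generalize dist y A = s' at *
  generalize dist y B = t' at *
  generalize dist x y = δ at *
  generalize D.len w = L at *
  have hx : 0 < s + t := by linarith
  have hy : 0 < s' + t' := by linarith
  have hδ : 0 ≤ δ := (abs_nonneg _).trans h3
  have e : s / (s + t) * L - s' / (s' + t') * L =
      (s * (t' - t) + t * (s - s')) * L / ((s + t) * (s' + t')) := by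
    field_simp
    ring
  rw [e, abs_div, abs_of_pos (mul_pos hx hy), div_le_iff₀ (mul_pos hx hy), abs_mul,
    abs_of_pos hL0]
  have h5 : |s * (t' - t) + t * (s - s')| ≤ (s + t) * δ := by
    refine (abs_add_le _ _).trans ?_
    rw [abs_mul, abs_mul, abs_of_nonneg hs, abs_of_nonneg ht, add_mul]
    gcongr
  calc |s * (t' - t) + t * (s - s')| * L ≤ (s + t) * δ * (s' + t') := by gcongr
    _ = δ * ((s + t) * (s' + t')) := by ring

end Collapse

section Bond

variable {F F' : Θ.FinSubtree} {v : V} {w : W} (h : F.Augments F' v w)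

theorem bond_base_of_mem {x : D.MT} (hx : x ∈ D.sub F.verts) (hx' : x ∈ D.sub F'.verts) :
    D.bond h (D.base F' x hx') = D.base F x hx :=
  dif_pos (c := x ∈ D.sub F.verts) hx

theorem bond_base_of_notMem {x : D.MT} (hx : x ∉ D.sub F.verts) (hx' : x ∈ D.sub F'.verts) :
    D.bond h (D.base F' x hx') = D.arc F w h.mem_periph
      (D.collapse F' w (inr_mem_of_augments h) (D.base F' x hx')) :=
  dif_neg (c := x ∈ D.sub F.verts) hx

theorem bond_arc_of_mem {w' : W} (hw : w' ∈ F.periph) (hw' : w' ∈ F'.periph)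
    (t : Icc (0 : ℝ) (D.len w')) :
    D.bond h (D.arc F' w' hw' t) = D.arc F w' hw t :=
  dif_pos (c := w' ∈ F.periph) hw

theorem bond_arc_of_notMem {w' : W} (hw : w' ∉ F.periph) (hw' : w' ∈ F'.periph)
    (t : Icc (0 : ℝ) (D.len w')) :
    D.bond h (D.arc F' w' hw' t) = D.arc F w h.mem_periph
      (D.collapse F' w (inr_mem_of_augments h) (D.arc F' w' hw' t)) :=
  dif_neg (c := w' ∈ F.periph) hw

include h in
/-- If `M_{F'}` is strictly larger than `M_F`, then the new vertex is `v`. -/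
theorem mem_sub_of_augments {x : D.MT} (hx : x ∉ D.sub F.verts) (hx' : x ∈ D.sub F'.verts) :
    Sum.inl v ∉ F.verts ∧ Sum.inr w ∈ F.verts ∧ x ∈ D.sub {.inl v} := by
  obtain ⟨u, hu, p, rfl⟩ := hx'
  have hmem : D.toMT u p ∈ D.sub {u} := D.mem_sub_of_mem (mem_singleton u) p
  have he := h.exactly_one
  rw [h.verts_eq] at hu
  rcases hu with hu | rfl | rfl
  · exact absurd (D.mem_sub_of_mem hu p) hx
  · have hv : Sum.inl v ∉ F.verts := fun hv => hx (D.mem_sub_of_mem hv p)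
    exact ⟨hv, by tauto, hmem⟩
  · have hw : Sum.inr w ∉ F.verts := fun hw => hx (D.mem_sub_of_mem hw p)
    have hv : Sum.inl v ∈ F.verts := by tauto
    exact absurd (D.sub_mono (singleton_subset_iff.2 hv) (D.sub_inr_subset h.adj hmem)) hx

theorem dist_arc_collapse_le (x y : D.Kettle F') :
    dist (D.arc F w h.mem_periph (D.collapse F' w (inr_mem_of_augments h) x))
      (D.arc F w h.mem_periph (D.collapse F' w (inr_mem_of_augments h) y)) ≤ dist x y :=
  (D.dist_arc_le F _ _ _).trans (D.abs_collapse_sub_le F' _ x y)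

theorem edist_bond_le (x y : D.Kettle F') : edist (D.bond h x) (D.bond h y) ≤ edist x y := by
  have mixed : ∀ x y (hx : x ∈ D.sub F.verts) (_ : y ∉ D.sub F.verts) (hx' : x ∈ D.sub F'.verts)
      (hy' : y ∈ D.sub F'.verts),
      dist (D.bond h (D.base F' x hx')) (D.bond h (D.base F' y hy')) ≤ dist x y := by
    intro x y hx hy hx' hy'
    obtain ⟨hv, hw, hyv⟩ := D.mem_sub_of_augments h hy hy'
    -- in the tree rooted at `w`, the subtree `F` contains no descendant of `v`
    obtain ⟨c, hc, hd⟩ := D.exists_dist_eq_add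
      (S := {t | Θ.T.Below (.inr w) (.inl v) t}) (w := w)
      (fun t ht t' ht' ha => by
        have h1 := (Θ.isTree.eq_of_adj_of_below ha ht ht').2
        exact Or.inr (Θ.isTree.eq_of_childOf h1
          ⟨h.adj.symm, by simp [SimpleGraph.dist_eq_one_iff_adj.2 h.adj.symm]⟩))
      (D.sub_mono (singleton_subset_iff.2 .refl) hyv)
      (D.sub_mono (fun t ht =>
        Θ.isTree.not_below_of_connected h.adj.symm F.connected hw hv ht) hx)
    have hcF : c ∈ D.sub F.verts := D.sub_mono (singleton_subset_iff.2 hw) hc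
    have hcF' : c ∈ D.sub F'.verts := D.sub_mono h.subset hcF
    rw [D.bond_base_of_mem h hx, D.bond_base_of_notMem h hy]
    refine (dist_triangle _ (D.base F c hcF) _).trans ?_
    rw [D.dist_base, ← D.arc_collapse_base h hv hw (D.sub_inr_subset h.adj hc) hcF hcF']
    refine (add_le_add_right (D.dist_arc_collapse_le h _ _) _).trans ?_
    rw [D.dist_base, dist_comm x y, hd, dist_comm y c, dist_comm x c, add_comm]
  refine D.edist_map_le F' (D.bond h) (fun x hx' y hy' => ?_) (fun w' hw' t t' => ?_) x y
  · rw [edist_dist, edist_dist]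
    refine ENNReal.ofReal_le_ofReal ?_
    by_cases hx : x ∈ D.sub F.verts <;> by_cases hy : y ∈ D.sub F.verts
    · rw [D.bond_base_of_mem h hx, D.bond_base_of_mem h hy, D.dist_base]
    · exact mixed x y hx hy _ _
    · rw [dist_comm, dist_comm x y]
      exact mixed y x hy hx _ _
    · rw [D.bond_base_of_notMem h hx, D.bond_base_of_notMem h hy, ← D.dist_base F' x y hx' hy']
      exact D.dist_arc_collapse_le h _ _
  · by_cases hw : w' ∈ F.periph
    · rw [D.bond_arc_of_mem h hw, D.bond_arc_of_mem h hw]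
      exact D.edist_arc_le F _ _ _
    · rw [D.bond_arc_of_notMem h hw, D.bond_arc_of_notMem h hw]
      refine le_trans ?_ (D.edist_arc_le F' hw' t t')
      rw [edist_dist, edist_dist]
      exact ENNReal.ofReal_le_ofReal (D.dist_arc_collapse_le h _ _)

end Bond

namespace IsBonding

variable {D} {F F₁ F' : Θ.FinSubtree}

theorem subset {f : D.Kettle F' → D.Kettle F} (hf : D.IsBonding F F' f) :
    F.verts ⊆ F'.verts := by
  induction hf with
  | refl => exact subset_rfl
  | step _ h ih => exact ih.trans h.subset

theorem edist_le {f : D.Kettle F' → D.Kettle F} (hf : D.IsBonding F F' f) (x y : D.Kettle F') :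
    edist (f x) (f y) ≤ edist x y := by
  induction hf with
  | refl => exact le_rfl
  | step _ h ih => exact (ih _ _).trans (D.edist_bond_le h x y)

theorem dist_le {f : D.Kettle F' → D.Kettle F} (hf : D.IsBonding F F' f) (x y : D.Kettle F') :
    dist (f x) (f y) ≤ dist x y := by
  have := hf.edist_le x y
  rw [edist_dist, edist_dist] at this
  exact (ENNReal.ofReal_le_ofReal_iff dist_nonneg).1 this

theorem continuous {f : D.Kettle F' → D.Kettle F} (hf : D.IsBonding F F' f) : Continuous f :=
  (LipschitzWith.of_edist_le hf.edist_le).continuous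

theorem apply_base {f : D.Kettle F' → D.Kettle F} (hf : D.IsBonding F F' f) {x : D.MT}
    (hx : x ∈ D.sub F.verts) (hx' : x ∈ D.sub F'.verts) :
    f (D.base F' x hx') = D.base F x hx := by
  induction hf with
  | refl => rfl
  | step hg h ih =>
    have hx₁ := D.sub_mono hg.subset hx
    change _ = D.base _ x hx
    rw [Function.comp, D.bond_base_of_mem h hx₁]
    exact ih hx₁

theorem trans {g : D.Kettle F₁ → D.Kettle F} {f : D.Kettle F' → D.Kettle F₁}
    (hg : D.IsBonding F F₁ g) (hf : D.IsBonding F₁ F' f) : D.IsBonding F F' (g ∘ f) := by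
  induction hf with
  | refl => exact hg
  | step _ h ih => exact ih.step h

theorem bond {v : V} {w : W} (h : F.Augments F' v w) : D.IsBonding F F' (D.bond h) :=
  (IsBonding.refl F).step h

/-- A bonding map is the identity, or its last factor is the bonding map of an edge at `F`. -/
theorem eq_id_or_eq_comp {f : D.Kettle F' → D.Kettle F} (hf : D.IsBonding F F' f) :
    (∃ e : F' = F, f = fun x => e ▸ x) ∨ ∃ (F₁ : Θ.FinSubtree) (v : V) (w : W)
      (h : F.Augments F₁ v w) (g : D.Kettle F' → D.Kettle F₁), D.IsBonding F₁ F' g ∧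
        f = D.bond h ∘ g := by
  induction hf with
  | refl => exact Or.inl ⟨rfl, rfl⟩
  | @step F₁ F' g v w hg h ih =>
    rcases ih with ⟨rfl, rfl⟩ | ⟨F₂, v', w', h', g', hg', rfl⟩
    · exact Or.inr ⟨F', v, w, h, id, .refl _, rfl⟩
    · exact Or.inr ⟨F₂, v', w', h', g' ∘ D.bond h, hg'.step h, rfl⟩

end IsBonding

end CompatibleMetrics

end TreeSystem

/-! ### The inverse system of kettlebell spaces -/

/-- Let `F` be a connected set of vertices of a tree that contains `w`, but not its neighbour
`v`. Going from `w` to `v` and on to another neighbour `w'` of `v`, all neighbours of `w'` lie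
outside of `F`. -/
theorem SimpleGraph.IsTree.notMem_of_adj {α : Type*} {G : SimpleGraph α} (hG : G.IsTree)
    {F : Set α} (hF : (G.induce F).Connected) {w v w' v' : α} (hw : w ∈ F) (hv : v ∉ F)
    (hwv : G.Adj w v) (hvw' : G.Adj v w') (hne : w' ≠ w) (h : G.Adj w' v') : v' ∉ F := by
  have hc : G.ChildOf w w v := ⟨hwv, by simp [SimpleGraph.dist_eq_one_iff_adj.2 hwv]⟩
  intro hv'
  have hn := hG.not_below_of_connected hwv hF hw hv hv'
  rcases hG.childOf_or_childOf w hvw' with h1 | h1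
  · rcases hG.childOf_or_childOf w h with h2 | h2
    · exact hn ((Relation.ReflTransGen.single h1).tail h2)
    · exact hv (hG.eq_of_childOf h2 h1 ▸ hv')
  · exact hne (hG.eq_of_childOf h1 hc)

/-- A vertex outside of a connected set of vertices of a tree has at most one neighbour in it. -/
theorem SimpleGraph.IsTree.eq_of_adj_of_mem {α : Type*} {G : SimpleGraph α} (hG : G.IsTree)
    {F : Set α} (hF : (G.induce F).Connected) {w v w' : α} (hw : w ∈ F) (hv : v ∉ F)
    (hwv : G.Adj w v) (hvw' : G.Adj v w') (hw' : w' ∈ F) : w' = w := by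
  have hc : G.ChildOf w w v := ⟨hwv, by simp [SimpleGraph.dist_eq_one_iff_adj.2 hwv]⟩
  rcases hG.childOf_or_childOf w hvw' with h1 | h1
  · exact absurd (.single h1) (hG.not_below_of_connected hwv hF hw hv hw')
  · exact hG.eq_of_childOf h1 hc

namespace TreeSystem

variable {V W : Type u} {Θ : TreeSystem V W}

namespace FinSubtree

/-- If two edges at `F` augment `F` to the same subtree, then they are equal. -/
theorem Augments.edge_unique {F F' : Θ.FinSubtree} {v v' : V} {w w' : W}
    (h : F.Augments F' v w) (h' : F.Augments F' v' w') : v = v' ∧ w = w' := by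
  have he := h.exactly_one
  have he' := h'.exactly_one
  have hs := h.verts_eq.symm.trans h'.verts_eq
  by_cases hv : Sum.inl v ∈ F.verts
  · have hw : Sum.inr w ∉ F.verts := by tauto
    have h1 : Sum.inr w ∈ F.verts ∪ {Sum.inl v', Sum.inr w'} := hs ▸ Or.inr (Or.inr rfl)
    have hww : w = w' := by simpa [hw] using h1
    subst hww
    have hv' : Sum.inl v' ∈ F.verts := by tauto
    have := Θ.isTree.eq_of_adj_of_mem F.connected hv' hw h'.adj h.adj.symm hv
    exact ⟨Sum.inl_injective this, rfl⟩
  · have hw : Sum.inr w ∈ F.verts := by tauto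
    have h1 : Sum.inl v ∈ F.verts ∪ {Sum.inl v', Sum.inr w'} := hs ▸ Or.inr (Or.inl rfl)
    have hvv : v = v' := by simpa [hv] using h1
    subst hvv
    have hw' : Sum.inr w' ∈ F.verts := by tauto
    have := Θ.isTree.eq_of_adj_of_mem F.connected hw' hv h'.adj.symm h.adj hw
    exact ⟨rfl, Sum.inr_injective this⟩

theorem exists_augments (F : Θ.FinSubtree) {v : V} {w : W} (h : Θ.T.Adj (.inl v) (.inr w))
    (he : ¬ (Sum.inl v ∈ F.verts ↔ Sum.inr w ∈ F.verts)) : ∃ F', F.Augments F' v w := by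
  refine ⟨⟨F.verts ∪ {.inl v, .inr w}, F.finite.union (by simp), ?_⟩, h, he, rfl⟩
  refine SimpleGraph.induce_union_connected F.connected.preconnected
    (SimpleGraph.induce_pair_connected_of_adj h).preconnected ?_
  by_cases hv : Sum.inl v ∈ F.verts
  · exact ⟨_, hv, Or.inl rfl⟩
  · exact ⟨.inr w, by tauto, Or.inr rfl⟩

/-- A finite subtree can be augmented inside of any larger finite subtree. -/
theorem exists_augments_subset {F F' : Θ.FinSubtree} (h : F.verts ⊆ F'.verts) (hne : F ≠ F') :
    ∃ F₁ v w, F.Augments F₁ v w ∧ F₁.verts ⊆ F'.verts := by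
  obtain ⟨⟨r, hr⟩⟩ := F.connected.nonempty
  obtain ⟨t, ht, htF⟩ : ∃ t ∈ F'.verts, t ∉ F.verts := by
    by_contra! hc
    exact hne (FinSubtree.ext (h.antisymm hc))
  obtain ⟨p⟩ := F'.connected.preconnected ⟨r, h hr⟩ ⟨t, ht⟩
  obtain ⟨d, -, h1, h2⟩ := p.exists_boundary_dart {s | s.1 ∈ F.verts} hr htF
  have ha : Θ.T.Adj d.fst.1 d.snd.1 := d.adj
  have hd1 : d.fst.1 ∈ F'.verts := d.fst.2
  have hd2 : d.snd.1 ∈ F'.verts := d.snd.2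
  rw [mem_ofPred_eq] at h1 h2
  generalize d.fst.1 = y at *
  generalize d.snd.1 = x at *
  rcases y with v | w <;> rcases x with v' | w'
  · exact absurd ha (Θ.not_adj_inl _ _)
  · obtain ⟨F₁, hF₁⟩ := F.exists_augments ha (by tauto)
    refine ⟨F₁, v, w', hF₁, ?_⟩
    rw [hF₁.verts_eq]
    exact union_subset h (insert_subset hd1 (singleton_subset_iff.2 hd2))
  · obtain ⟨F₁, hF₁⟩ := F.exists_augments ha.symm (by tauto)
    refine ⟨F₁, v', w, hF₁, ?_⟩
    rw [hF₁.verts_eq]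
    exact union_subset h (insert_subset hd2 (singleton_subset_iff.2 hd1))
  · exact absurd ha (Θ.not_adj_inr _ _)

theorem Augments.ncard_diff_lt {F F₁ F' : Θ.FinSubtree} {v : V} {w : W}
    (h : F.Augments F₁ v w) (hs : F₁.verts ⊆ F'.verts) :
    (F'.verts \ F₁.verts).ncard < (F'.verts \ F.verts).ncard := by
  have he := h.exactly_one
  have hv : Sum.inl v ∈ F₁.verts := h.verts_eq ▸ Or.inr (Or.inl rfl)
  have hw : Sum.inr w ∈ F₁.verts := h.verts_eq ▸ Or.inr (Or.inr rfl)
  refine ncard_lt_ncard ⟨sdiff_subset_sdiff_right h.subset, fun hc => ?_⟩ (F'.finite.sdiff)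
  by_cases hvF : Sum.inl v ∈ F.verts
  · exact (hc ⟨hs hw, by tauto⟩).2 hw
  · exact (hc ⟨hs hv, hvF⟩).2 hv

theorem Augments.ne {F F₁ : Θ.FinSubtree} {v : V} {w : W} (h : F.Augments F₁ v w) : F₁ ≠ F := by
  rintro rfl
  exact lt_irrefl _ (h.ncard_diff_lt subset_rfl)

/-- Two different augmentations of `F` have a common augmentation. -/
theorem Augments.exists_union {F F₁ F₂ : Θ.FinSubtree} {v₁ v₂ : V} {w₁ w₂ : W}
    (h₁ : F.Augments F₁ v₁ w₁) (h₂ : F.Augments F₂ v₂ w₂) (hne : F₁ ≠ F₂) :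
    ∃ F₃ : Θ.FinSubtree, F₃.verts = F₁.verts ∪ F₂.verts ∧ F₁.Augments F₃ v₂ w₂ ∧
      F₂.Augments F₃ v₁ w₁ := by
  have key : ∀ {F₁ F₂ : Θ.FinSubtree} {v₁ v₂ : V} {w₁ w₂ : W}, F.Augments F₁ v₁ w₁ →
      F.Augments F₂ v₂ w₂ → F₁ ≠ F₂ → ¬ (Sum.inl v₂ ∈ F₁.verts ↔ Sum.inr w₂ ∈ F₁.verts) := by
    intro F₁ F₂ v₁ v₂ w₁ w₂ h₁ h₂ hne hiff
    have e₁ := h₁.exactly_one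
    have e₂ := h₂.exactly_one
    have hs : Sum.inl v₂ ∈ F₁.verts ∧ Sum.inr w₂ ∈ F₁.verts := by
      by_cases hv : Sum.inl v₂ ∈ F.verts
      · exact ⟨h₁.subset hv, hiff.1 (h₁.subset hv)⟩
      · have hw : Sum.inr w₂ ∈ F.verts := by tauto
        exact ⟨hiff.2 (h₁.subset hw), h₁.subset hw⟩
    have hsub : F₂.verts ⊆ F₁.verts := by
      rw [h₂.verts_eq]
      exact union_subset h₁.subset (insert_subset hs.1 (singleton_subset_iff.2 hs.2))
    have hlt := h₂.ncard_diff_lt hsub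
    have hle : (F₁.verts \ F.verts).ncard ≤ 1 := by
      rw [ncard_le_one (F₁.finite.sdiff)]
      rintro x ⟨hx, hxF⟩ y ⟨hy, hyF⟩
      rw [h₁.verts_eq] at hx hy
      rcases hx with hx | rfl | rfl
      · exact absurd hx hxF
      · rcases hy with hy | rfl | rfl
        · exact absurd hy hyF
        · rfl
        · exact absurd (iff_of_false hxF hyF) e₁
      · rcases hy with hy | rfl | rfl
        · exact absurd hy hyF
        · exact absurd (iff_of_false hyF hxF) e₁
        · rfl
    have h0 : (F₁.verts \ F₂.verts).ncard = 0 := by omega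
    rw [ncard_eq_zero (F₁.finite.sdiff), sdiff_eq_empty] at h0
    exact hne (FinSubtree.ext (h0.antisymm hsub))
  obtain ⟨⟨r, hr⟩⟩ := F.connected.nonempty
  refine ⟨⟨F₁.verts ∪ F₂.verts, F₁.finite.union F₂.finite,
    SimpleGraph.induce_union_connected F₁.connected.preconnected F₂.connected.preconnected
      ⟨r, h₁.subset hr, h₂.subset hr⟩⟩, rfl, ⟨h₂.adj, key h₁ h₂ hne, ?_⟩,
    ⟨h₁.adj, key h₂ h₁ hne.symm, ?_⟩⟩
  · change F₁.verts ∪ F₂.verts = _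
    rw [h₁.verts_eq, h₂.verts_eq]
    ext x
    simp only [mem_union]
    tauto
  · change F₁.verts ∪ F₂.verts = _
    rw [h₁.verts_eq, h₂.verts_eq]
    ext x
    simp only [mem_union]
    tauto

end FinSubtree

namespace CompatibleMetrics

variable (D : Θ.CompatibleMetrics)

theorem collapse_base_eq {F F' : Θ.FinSubtree} {w : W} (hw : Sum.inr w ∈ F.verts)
    (hw' : Sum.inr w ∈ F'.verts) {x : D.MT} (hx : x ∈ D.sub F.verts) (hx' : x ∈ D.sub F'.verts) :
    D.collapse F w hw (D.base F x hx) = D.collapse F' w hw' (D.base F' x hx') := by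
  apply Subtype.ext
  rw [D.collapse_val, D.collapse_val]
  simp only [D.dist_base]

theorem collapse_arc_eq {F F' : Θ.FinSubtree} {w : W} (hw : Sum.inr w ∈ F.verts)
    (hw' : Sum.inr w ∈ F'.verts) {w₁ : W} (h₁ : w₁ ∈ F.periph) (h₁' : w₁ ∈ F'.periph)
    (t : Icc (0 : ℝ) (D.len w₁)) :
    D.collapse F w hw (D.arc F w₁ h₁ t) = D.collapse F' w hw' (D.arc F' w₁ h₁' t) := by
  apply Subtype.ext
  rw [D.collapse_val, D.collapse_val]
  simp only [D.dist_arc_base]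

/-- The bonding maps for two different edges at `F` commute. -/
theorem bond_bond_comm {F F₁ F₂ F₃ : Θ.FinSubtree} {v₁ v₂ : V} {w₁ w₂ : W}
    (h₁ : F.Augments F₁ v₁ w₁) (h₂ : F.Augments F₂ v₂ w₂) (h₁' : F₂.Augments F₃ v₁ w₁)
    (h₂' : F₁.Augments F₃ v₂ w₂) (y : D.Kettle F₃) :
    D.bond h₁ (D.bond h₂' y) = D.bond h₂ (D.bond h₁' y) := by
  -- points of `M_{F₁}` outside of `M_F`
  have hpt : ∀ {F₁ F₂ : Θ.FinSubtree} {v₁ v₂ : V} {w₁ w₂ : W} (h₁ : F.Augments F₁ v₁ w₁)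
      (h₂ : F.Augments F₂ v₂ w₂) (h₁' : F₂.Augments F₃ v₁ w₁) (h₂' : F₁.Augments F₃ v₂ w₂)
      (x : D.MT) (hx₃ : x ∈ D.sub F₃.verts), x ∈ D.sub F₁.verts → x ∉ D.sub F.verts →
      D.bond h₁ (D.bond h₂' (D.base F₃ x hx₃)) = D.bond h₂ (D.bond h₁' (D.base F₃ x hx₃)) := by
    intro F₁ F₂ v₁ v₂ w₁ w₂ h₁ h₂ h₁' h₂' x hx₃ hx₁ hx
    obtain ⟨hv, hw, hxv⟩ := D.mem_sub_of_augments h₁ hx hx₁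
    have hv₂ : Sum.inl v₁ ∉ F₂.verts := fun hv₂ =>
      h₁'.exactly_one (iff_of_true hv₂ (h₂.subset hw))
    have hx₂ : x ∉ D.sub F₂.verts := fun hx₂ => hx (D.sub_mono (singleton_subset_iff.2 hw)
      (D.mem_sub_pair F₂ h₁.adj hv₂ (h₂.subset hw) hxv hx₂))
    rw [D.bond_base_of_mem h₂' hx₁, D.bond_base_of_notMem h₁ hx, D.bond_base_of_notMem h₁' hx₂,
      D.bond_arc_of_mem h₂ h₁.mem_periph]
    exact congrArg _ (D.collapse_base_eq _ _ _ _)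
  -- points of peripheral arcs of `F₁` that do not belong to `F₂`
  have harc : ∀ {F₁ F₂ : Θ.FinSubtree} {v₁ v₂ : V} {w₁ w₂ : W} (h₁ : F.Augments F₁ v₁ w₁)
      (h₂ : F.Augments F₂ v₂ w₂) (h₁' : F₂.Augments F₃ v₁ w₁) (h₂' : F₁.Augments F₃ v₂ w₂)
      (w' : W) (hw₃ : w' ∈ F₃.periph) (t : Icc (0 : ℝ) (D.len w')), w' ∈ F₁.periph →
      w' ∉ F₂.periph →
      D.bond h₁ (D.bond h₂' (D.arc F₃ w' hw₃ t)) = D.bond h₂ (D.bond h₁' (D.arc F₃ w' hw₃ t)) := by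
    intro F₁ F₂ v₁ v₂ w₁ w₂ h₁ h₂ h₁' h₂' w' hw₃ t hw₁ hw₂
    obtain ⟨hv, hw, ha⟩ := periph_of_augments h₁' hw₃ hw₂
    have hw' : w' ∉ F.periph := by
      rintro ⟨v₃, ha₃, hn₃⟩
      have hwF : Sum.inr w' ∉ F.verts := fun hwF =>
        hw₂ ⟨v₁, ha, fun hiff => hv (hiff.2 (h₂.subset hwF))⟩
      have hv₃ : Sum.inl v₃ ∈ F.verts := by tauto
      have hvF : Sum.inl v₁ ∉ F.verts := fun h => hv (h₂.subset h)
      have hw₁F : Sum.inr w₁ ∈ F.verts := by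
        have := h₁.exactly_one
        tauto
      exact Θ.isTree.notMem_of_adj F.connected hw₁F hvF h₁.adj.symm ha
        (fun he => hwF (he ▸ hw₁F)) ha₃.symm hv₃
    rw [D.bond_arc_of_mem h₂' hw₁, D.bond_arc_of_notMem h₁ hw', D.bond_arc_of_notMem h₁' hw₂,
      D.bond_arc_of_mem h₂ h₁.mem_periph]
    exact congrArg _ (D.collapse_arc_eq _ _ _ _ _)
  have hsub : ∀ x : V ⊕ W, x ∈ F₃.verts → x ∈ F₁.verts ∨ x ∈ F₂.verts := by
    intro x hx
    rw [h₁'.verts_eq] at hx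
    rw [h₁.verts_eq]
    rcases hx with hx | hx
    · exact Or.inr hx
    · exact Or.inl (Or.inr hx)
  rcases D.exists_base_or_arc F₃ y with ⟨x, hx₃, rfl⟩ | ⟨w', hw₃, t, rfl⟩
  · by_cases hx : x ∈ D.sub F.verts
    · rw [D.bond_base_of_mem h₂' (D.sub_mono h₁.subset hx), D.bond_base_of_mem h₁ hx,
        D.bond_base_of_mem h₁' (D.sub_mono h₂.subset hx), D.bond_base_of_mem h₂ hx]
    · obtain ⟨u, hu, p, rfl⟩ := id hx₃
      rcases hsub u hu with hu | hu
      · exact hpt h₁ h₂ h₁' h₂' _ hx₃ (D.mem_sub_of_mem hu p) hx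
      · exact (hpt h₂ h₁ h₂' h₁' _ hx₃ (D.mem_sub_of_mem hu p) hx).symm
  · by_cases hw₁ : w' ∈ F₁.periph <;> by_cases hw₂ : w' ∈ F₂.periph
    · by_cases hw : w' ∈ F.periph
      · rw [D.bond_arc_of_mem h₂' hw₁, D.bond_arc_of_mem h₁ hw, D.bond_arc_of_mem h₁' hw₂,
          D.bond_arc_of_mem h₂ hw]
      · -- impossible: `w'` would close a cycle
        obtain ⟨hv1, hw1, ha1⟩ := periph_of_augments h₁ hw₁ hw
        obtain ⟨hv2, hw2, ha2⟩ := periph_of_augments h₂ hw₂ hw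
        have hv : Sum.inl v₁ ∉ F₂.verts := fun hv =>
          h₁'.exactly_one (iff_of_true hv (h₂.subset hw1))
        have hv₂ : Sum.inl v₂ ∈ F₂.verts := h₂.verts_eq ▸ Or.inr (Or.inl rfl)
        refine absurd hv₂ (Θ.isTree.notMem_of_adj F₂.connected (h₂.subset hw1) hv h₁.adj.symm ha1
          (fun he => ?_) ha2.symm)
        exact hw (Sum.inr_injective he ▸ h₁.mem_periph)
    · exact harc h₁ h₂ h₁' h₂' w' hw₃ t hw₁ hw₂
    · exact (harc h₂ h₁ h₂' h₁' w' hw₃ t hw₂ hw₁).symm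
    · -- impossible: `w'` would close a cycle
      obtain ⟨hv1, hw1, ha1⟩ := periph_of_augments h₁' hw₃ hw₂
      obtain ⟨hv2, hw2, ha2⟩ := periph_of_augments h₂' hw₃ hw₁
      have hv₂ : Sum.inl v₂ ∈ F₂.verts := h₂.verts_eq ▸ Or.inr (Or.inl rfl)
      refine absurd hv₂ (Θ.isTree.notMem_of_adj F₂.connected hw1 hv1 h₁.adj.symm ha1
        (fun he => ?_) ha2.symm)
      have he := Sum.inr_injective he
      subst he
      exact hw₂ ⟨v₁, ha1, fun hiff => hv1 (hiff.2 hw1)⟩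

theorem exists_isBonding {F F' : Θ.FinSubtree} (h : F.verts ⊆ F'.verts) :
    ∃ f, D.IsBonding F F' f := by
  induction hn : (F'.verts \ F.verts).ncard using Nat.strong_induction_on generalizing F with
  | _ n ih =>
    by_cases hne : F = F'
    · subst hne
      exact ⟨id, .refl F⟩
    · obtain ⟨F₁, v, w, h1, h2⟩ := FinSubtree.exists_augments_subset h hne
      obtain ⟨g, hg⟩ := ih _ (hn ▸ h1.ncard_diff_lt h2) h2 rfl
      exact ⟨_, (IsBonding.bond h1).trans hg⟩

/-- The composition of the bonding maps along an augmenting chain does not depend on the chain. -/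
theorem IsBonding.unique {D : Θ.CompatibleMetrics} {F F' : Θ.FinSubtree}
    {f g : D.Kettle F' → D.Kettle F} (hf : D.IsBonding F F' f) (hg : D.IsBonding F F' g) :
    f = g := by
  induction hn : (F'.verts \ F.verts).ncard using Nat.strong_induction_on generalizing F with
  | _ n ih =>
    rcases hf.eq_id_or_eq_comp with ⟨e, rfl⟩ | ⟨F₁, v₁, w₁, h₁, f₁, hf₁, rfl⟩ <;>
      rcases hg.eq_id_or_eq_comp with ⟨e', rfl⟩ | ⟨F₂, v₂, w₂, h₂, f₂, hf₂, rfl⟩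
    · rfl
    · exact absurd (FinSubtree.ext ((e ▸ hf₂.subset).antisymm h₂.subset)) h₂.ne
    · exact absurd (FinSubtree.ext ((e' ▸ hf₁.subset).antisymm h₁.subset)) h₁.ne
    · have hlt₁ := hn ▸ h₁.ncard_diff_lt hf₁.subset
      have hlt₂ := hn ▸ h₂.ncard_diff_lt hf₂.subset
      by_cases hne : F₁ = F₂
      · subst hne
        obtain ⟨rfl, rfl⟩ := h₁.edge_unique h₂
        rw [ih _ hlt₁ hf₁ hf₂ rfl]
      · obtain ⟨F₃, hF₃, h₂', h₁'⟩ := h₁.exists_union h₂ hne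
        obtain ⟨k, hk⟩ := D.exists_isBonding (F := F₃) (F' := F')
          (hF₃ ▸ union_subset hf₁.subset hf₂.subset)
        rw [ih _ hlt₁ hf₁ ((IsBonding.bond h₂').trans hk) rfl,
          ih _ hlt₂ hf₂ ((IsBonding.bond h₁').trans hk) rfl]
        funext y
        exact D.bond_bond_comm h₁ h₂ h₁' h₂' (k y)

end CompatibleMetrics

end TreeSystem

/-! ### The natural map and its extension to the completion -/

namespace TreeSystem.CompatibleMetrics

variable {V W : Type u} {Θ : TreeSystem V W} (D : Θ.CompatibleMetrics)

/-- Any two finite subtrees and any point of `M_T` are contained in a finite subtree. -/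
theorem exists_finSubtree_mem (F F' : Θ.FinSubtree) (x : D.MT) :
    ∃ F₁ : Θ.FinSubtree, F.verts ⊆ F₁.verts ∧ F'.verts ⊆ F₁.verts ∧ x ∈ D.sub F₁.verts := by
  obtain ⟨u, p, rfl⟩ := D.exists_toMT x
  obtain ⟨F₁, hF₁⟩ := Θ.exists_finSubtree
    (B := insert u (F.verts ∪ F'.verts)) ((F.finite.union F'.finite).insert u) (insert_nonempty _ _)
  exact ⟨F₁, fun t ht => hF₁ (Or.inr (Or.inl ht)), fun t ht => hF₁ (Or.inr (Or.inr ht)),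
    D.mem_sub_of_mem (hF₁ (mem_insert _ _)) p⟩

/-- The coordinate of the natural map at `F`: two subtrees that contain `x` are compared inside of a
third one, on which the bonding maps to `F` agree. -/
theorem exists_natural_coord (F : Θ.FinSubtree) (x : D.MT) : ∃ y : D.Kettle F,
    ∀ (F' : Θ.FinSubtree) (f : D.Kettle F' → D.Kettle F), D.IsBonding F F' f →
      ∀ hx : x ∈ D.sub F'.verts, y = f (D.base F' x hx) := by
  obtain ⟨F₁, h₁, -, hx₁⟩ := D.exists_finSubtree_mem F F x
  obtain ⟨f₁, hf₁⟩ := D.exists_isBonding h₁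
  refine ⟨f₁ (D.base F₁ x hx₁), fun F' f hf hx => ?_⟩
  obtain ⟨F₂, h₂, h', hx₂⟩ := D.exists_finSubtree_mem F₁ F' x
  obtain ⟨g₁, hg₁⟩ := D.exists_isBonding h₂
  obtain ⟨g, hg⟩ := D.exists_isBonding h'
  rw [← hg₁.apply_base hx₁ hx₂, ← hg.apply_base hx hx₂]
  exact congrFun ((hf₁.trans hg₁).unique (hf.trans hg)) _

theorem existsUnique_naturalMap : ∃! γ : D.MT → D.MΘ, D.IsNaturalMap γ := by
  choose c hc using D.exists_natural_coord
  refine ⟨fun x => ⟨fun F => c F x, fun F F' f hf => ?_⟩, fun F F' f hf x hx => hc F x F' f hf hx,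
    fun γ hγ => ?_⟩
  · obtain ⟨F₁, h₁, -, hx₁⟩ := D.exists_finSubtree_mem F' F' x
    obtain ⟨g, hg⟩ := D.exists_isBonding h₁
    change f (c F' x) = c F x
    rw [hc F x F₁ _ (hf.trans hg) hx₁, hc F' x F₁ _ hg hx₁]
    rfl
  · funext x
    refine Subtype.ext (funext fun F => ?_)
    obtain ⟨F₁, h₁, -, hx₁⟩ := D.exists_finSubtree_mem F F x
    obtain ⟨g, hg⟩ := D.exists_isBonding h₁
    rw [hγ F F₁ g hg x hx₁]
    exact (hc F x F₁ g hg hx₁).symm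

instance : T2Space D.MΘ := inferInstanceAs (T2Space (Subtype _))

namespace IsNaturalMap

variable {D} {γ : D.MT → D.MΘ} (hγ : D.IsNaturalMap γ)

include hγ

theorem apply_of_mem {F : Θ.FinSubtree} {x : D.MT} (hx : x ∈ D.sub F.verts) :
    (γ x).1 F = D.base F x hx := hγ F F id (.refl F) x hx

theorem dist_apply_le (F : Θ.FinSubtree) (x y : D.MT) :
    dist ((γ x).1 F) ((γ y).1 F) ≤ dist x y := by
  obtain ⟨F₁, h₁, -, hx⟩ := D.exists_finSubtree_mem F F x
  obtain ⟨F₂, h₂, -, hy⟩ := D.exists_finSubtree_mem F₁ F₁ y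
  obtain ⟨f, hf⟩ := D.exists_isBonding (h₁.trans h₂)
  rw [hγ F F₂ f hf x (D.sub_mono h₂ hx), hγ F F₂ f hf y hy]
  exact (hf.dist_le _ _).trans (D.dist_base F₂ _ _ _ _).le

theorem uniformContinuous_apply (F : Θ.FinSubtree) : UniformContinuous fun x => (γ x).1 F :=
  (LipschitzWith.of_dist_le_mul (K := 1) fun x y => by
    rw [NNReal.coe_one, one_mul]
    exact hγ.dist_apply_le F x y).uniformContinuous

/-- If `M_F` is `ε`-dense in `M_T`, then the coordinate of the natural map at `F` shrinks distances
by at most `4 * ε`, since it is `1`-Lipschitz and isometric on `M_F`. -/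
theorem dist_le_of_dense {F : Θ.FinSubtree} {ε : ℝ}
    (hF : ∀ x : D.MT, ∃ y ∈ D.sub F.verts, dist x y ≤ ε) (x y : D.MT) :
    dist x y ≤ dist ((γ x).1 F) ((γ y).1 F) + 4 * ε := by
  obtain ⟨x', hx', hxx⟩ := hF x
  obtain ⟨y', hy', hyy⟩ := hF y
  have h1 := hγ.dist_apply_le F x x'
  have h2 := hγ.dist_apply_le F y y'
  have h3 : dist ((γ x').1 F) ((γ y').1 F) = dist x' y' := by
    rw [hγ.apply_of_mem hx', hγ.apply_of_mem hy', D.dist_base]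
  have h4 := dist_triangle4 x x' y' y
  have h5 := dist_triangle4 ((γ x').1 F) ((γ x).1 F) ((γ y).1 F) ((γ y').1 F)
  rw [dist_comm ((γ x').1 F) ((γ x).1 F)] at h5
  rw [dist_comm y' y] at h4
  linarith

end IsNaturalMap

namespace IsShrinking

variable {D} {v₀ : V} (hD : D.IsShrinking v₀)

include hD

theorem compactSpace_completion : CompactSpace (UniformSpace.Completion D.MT) := by
  refine ⟨TotallyBounded.isCompact_of_isClosed ?_ isClosed_univ⟩
  have h := hD.totallyBounded.image (UniformSpace.Completion.uniformContinuous_coe D.MT)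
  have h2 := h.closure
  rwa [image_univ, UniformSpace.Completion.denseRange_coe.closure_range] at h2

/-- The natural map extends to a homeomorphism of the completion onto the inverse limit. -/
theorem exists_homeomorph {γ : D.MT → D.MΘ} (hγ : D.IsNaturalMap γ) :
    ∃ Γ : UniformSpace.Completion D.MT ≃ₜ D.MΘ, ∀ x : D.MT, Γ x = γ x := by
  have hcomp := hD.compactSpace_completion
  have hK := hD.compactSpace_kettle
  let c : ∀ F, UniformSpace.Completion D.MT → D.Kettle F := fun F =>
    UniformSpace.Completion.extension fun x => (γ x).1 F
  have hc : ∀ F, Continuous (c F) := fun F => UniformSpace.Completion.continuous_extension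
  have hcx : ∀ F (x : D.MT), c F x = (γ x).1 F := fun F x =>
    UniformSpace.Completion.extension_coe (hγ.uniformContinuous_apply F) x
  have hcompat : ∀ z (F F' : Θ.FinSubtree) (f : D.Kettle F' → D.Kettle F),
      D.IsBonding F F' f → f (c F' z) = c F z := by
    intro z F F' f hf
    induction z using UniformSpace.Completion.induction_on with
    | hp => exact isClosed_eq (hf.continuous.comp (hc F')) (hc F)
    | ih x =>
      rw [hcx, hcx]
      exact (γ x).2 F F' f hf
  let g : UniformSpace.Completion D.MT → D.MΘ := fun z => ⟨fun F => c F z, hcompat z⟩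
  have hg : Continuous g := Continuous.subtype_mk (continuous_pi hc) _
  have hinj : Function.Injective g := by
    intro z z' h
    refine _root_.eq_of_dist_eq_zero (le_antisymm (le_of_forall_pos_le_add fun ε hε => ?_) dist_nonneg)
    obtain ⟨F, hF⟩ := hD.exists_finSubtree_dense (ε := ε / 4) (by positivity)
    have key : dist z z' ≤ dist (c F z) (c F z') + 4 * (ε / 4) := by
      clear h
      induction z, z' using UniformSpace.Completion.induction_on₂ with
      | hp =>
        exact isClosed_le continuous_dist ((((hc F).comp continuous_fst).dist
          ((hc F).comp continuous_snd)).add continuous_const)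
      | ih x y =>
        rw [hcx, hcx, UniformSpace.Completion.dist_eq]
        exact hγ.dist_le_of_dense hF x y
    have h2 : c F z = c F z' := congrFun (congrArg Subtype.val h) F
    rw [h2, dist_self] at key
    linarith
  have hsurj : Function.Surjective g := by
    intro y
    let K : Θ.FinSubtree × {ε : ℝ // 0 < ε} → Set (UniformSpace.Completion D.MT) := fun i =>
      {z | dist (c i.1 z) (y.1 i.1) ≤ i.2.1}
    have hKc : ∀ i, IsClosed (K i) := fun i =>
      isClosed_le ((hc i.1).dist continuous_const) continuous_const
    have hne : (⋂ i, K i).Nonempty := by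
      have : Nonempty (Θ.FinSubtree × {ε : ℝ // 0 < ε}) := by
        obtain ⟨F, -⟩ := Θ.exists_finSubtree (finite_singleton (Sum.inl v₀)) (singleton_nonempty _)
        exact ⟨F, 1, one_pos⟩
      refine IsCompact.nonempty_iInter_of_directed_nonempty_isCompact_isClosed K ?_ ?_
        (fun i => (hKc i).isCompact) hKc
      · rintro ⟨F, ε, hε⟩ ⟨F', ε', hε'⟩
        obtain ⟨F₁, h1, h2⟩ : ∃ F₁ : Θ.FinSubtree, F.verts ⊆ F₁.verts ∧ F'.verts ⊆ F₁.verts := by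
          obtain ⟨⟨r, hr⟩⟩ := F.connected.nonempty
          obtain ⟨F₁, hF₁⟩ := Θ.exists_finSubtree (F.finite.union F'.finite) ⟨r, Or.inl hr⟩
          exact ⟨F₁, subset_union_left.trans hF₁, subset_union_right.trans hF₁⟩
        have mono : ∀ {F : Θ.FinSubtree}, F.verts ⊆ F₁.verts → ∀ z,
            dist (c F z) (y.1 F) ≤ dist (c F₁ z) (y.1 F₁) := by
          intro F h z
          obtain ⟨f, hf⟩ := D.exists_isBonding h
          rw [← hcompat z F F₁ f hf, ← y.2 F F₁ f hf]
          exact hf.dist_le _ _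
        exact ⟨⟨F₁, min ε ε', lt_min hε hε'⟩,
          fun z hz => (mono h1 z).trans (le_trans hz (min_le_left _ _)),
          fun z hz => (mono h2 z).trans (le_trans hz (min_le_right _ _))⟩
      · rintro ⟨F, ε, hε⟩
        obtain ⟨B, hB, -, hBF⟩ := hD.exists_finite_dense hε
        obtain ⟨⟨r, hr⟩⟩ := F.connected.nonempty
        obtain ⟨F₁, hF₁⟩ := Θ.exists_finSubtree (F.finite.union hB) ⟨r, Or.inl hr⟩
        have hper := (hBF F₁ (subset_union_right.trans hF₁)).2
        obtain ⟨f, hf⟩ := D.exists_isBonding (F := F) (F' := F₁) (subset_union_left.trans hF₁)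
        obtain ⟨x, hx, hxy⟩ : ∃ x, ∃ hx : x ∈ D.sub F₁.verts,
            dist (D.base F₁ x hx) (y.1 F₁) ≤ ε := by
          rcases D.exists_base_or_arc F₁ (y.1 F₁) with ⟨x, hx, he⟩ | ⟨w, hw, t, he⟩
          · exact ⟨x, hx, by rw [he, dist_self]; exact hε.le⟩
          · refine ⟨D.a w, D.a_mem_of_periph hw, ?_⟩
            rw [he, ← D.arc_left F₁ w hw, dist_comm]
            refine (D.dist_arc_le F₁ hw _ _).trans ?_
            rw [sub_zero, abs_of_nonneg t.2.1]
            exact t.2.2.trans (hper w hw)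
        refine ⟨(x : UniformSpace.Completion D.MT), ?_⟩
        change dist (c F x) (y.1 F) ≤ ε
        rw [← hcompat x F F₁ f hf, ← y.2 F F₁ f hf]
        refine (hf.dist_le _ _).trans ?_
        rw [hcx, hγ.apply_of_mem hx]
        exact hxy
    obtain ⟨z, hz⟩ := hne
    refine ⟨z, Subtype.ext (funext fun F => D.eq_of_dist_eq_zero_kettle F ?_)⟩
    refine le_antisymm (le_of_forall_pos_le_add fun ε hε => ?_) dist_nonneg
    rw [zero_add]
    exact mem_iInter.1 hz (F, ⟨ε, hε⟩)
  let e := hg.homeoOfEquivCompactToT2 (f := Equiv.ofBijective g ⟨hinj, hsurj⟩)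
  exact ⟨e, fun x => Subtype.ext (funext fun F => hcx F x)⟩

end IsShrinking

end TreeSystem.CompatibleMetrics

/-! ### Rays in rooted trees -/

namespace SimpleGraph

variable {α : Type*} {G : SimpleGraph α}

theorem Below.eq_of_dist_le {r s t : α} (h : G.Below r s t) (hd : G.dist r t ≤ G.dist r s) :
    s = t := by
  cases h with
  | refl => rfl
  | tail h1 h2 =>
    have h3 := Below.dist_le h1
    have h4 := h2.2
    omega

end SimpleGraph

namespace TreeSystem

variable {V W : Type u} {Θ : TreeSystem V W}

namespace Ray

variable {α : Type u} {G : SimpleGraph α}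

/-- A tail of a ray. -/
def shift (ρ : Ray G) (n : ℕ) : Ray G where
  toFun k := ρ.toFun (n + k)
  injective _ _ h := Nat.add_left_cancel (ρ.injective h)
  adj k := ρ.adj (n + k)

theorem mk_shift (ρ : Ray G) (n : ℕ) :
    Quotient.mk (raySetoid G) (ρ.shift n) = Quotient.mk (raySetoid G) ρ :=
  Quotient.sound ⟨0, n, fun k => by simp [shift]⟩

/-- From some point on, a ray in a rooted tree leads away from the root. -/
theorem exists_forall_childOf (hG : G.IsTree) (r : α) (ρ : Ray G) :
    ∃ N, ∀ n, N ≤ n → G.ChildOf r (ρ.toFun n) (ρ.toFun (n + 1)) := by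
  obtain ⟨N, hN⟩ : ∃ N, G.ChildOf r (ρ.toFun N) (ρ.toFun (N + 1)) := by
    by_contra! hc
    have key : ∀ n, G.dist r (ρ.toFun n) + n ≤ G.dist r (ρ.toFun 0) := by
      intro n
      induction n with
      | zero => simp
      | succ n ih =>
        have := ((hG.childOf_or_childOf r (ρ.adj n)).resolve_left (hc n)).2
        omega
    have := key (G.dist r (ρ.toFun 0) + 1)
    omega
  refine ⟨N, fun n hn => ?_⟩
  induction n, hn using Nat.le_induction with
  | base => exact hN
  | succ n _ ih =>
    refine (hG.childOf_or_childOf r (ρ.adj (n + 1))).resolve_right fun h => ?_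
    have := ρ.injective (hG.eq_of_childOf ih h)
    omega

section Descending

variable {r : α} {ρ : Ray G} {N : ℕ}
  (hρ : ∀ n, N ≤ n → G.ChildOf r (ρ.toFun n) (ρ.toFun (n + 1)))

include hρ

theorem below_of_le {n m : ℕ} (hn : N ≤ n) (hm : n ≤ m) :
    G.Below r (ρ.toFun n) (ρ.toFun m) := by
  induction m, hm using Nat.le_induction with
  | base => exact .refl
  | succ m hm ih => exact ih.tail (hρ m (hn.trans hm))

theorem dist_eq {n : ℕ} (hn : N ≤ n) :
    G.dist r (ρ.toFun n) + N = G.dist r (ρ.toFun N) + n := by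
  induction n, hn using Nat.le_induction with
  | base => rfl
  | succ n hn ih =>
    have := (hρ n hn).2
    omega

/-- The ancestors of the vertices of a descending ray lie on the ray. -/
theorem exists_eq_of_below (hG : G.IsTree) {s : α} {m : ℕ} (hm : N ≤ m)
    (h : G.Below r s (ρ.toFun m)) (hs : G.dist r (ρ.toFun N) ≤ G.dist r s) :
    ∃ m', N ≤ m' ∧ s = ρ.toFun m' := by
  induction m, hm using Nat.le_induction with
  | base => exact ⟨N, le_rfl, h.eq_of_dist_le hs⟩
  | succ m hm ih =>
    by_cases he : s = ρ.toFun (m + 1)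
    · exact ⟨m + 1, by omega, he⟩
    · exact ih (hG.below_of_childOf h (hρ m hm) (Ne.symm he))

end Descending

/-- Two rays are equivalent if the first passes through ancestors of vertices of the second
arbitrarily far out. -/
theorem mk_eq_mk_of_below (hG : G.IsTree) {r : α} {ρ σ : Ray G} {N N' : ℕ}
    (hρ : ∀ n, N ≤ n → G.ChildOf r (ρ.toFun n) (ρ.toFun (n + 1)))
    (hσ : ∀ n, N' ≤ n → G.ChildOf r (σ.toFun n) (σ.toFun (n + 1)))
    (h : ∀ n, N ≤ n → ∃ m, N' ≤ m ∧ G.Below r (ρ.toFun n) (σ.toFun m)) :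
    Quotient.mk (raySetoid G) ρ = Quotient.mk (raySetoid G) σ := by
  have key : ∀ n, N + G.dist r (σ.toFun N') ≤ n → ∃ m, N' ≤ m ∧ ρ.toFun n = σ.toFun m := by
    intro n hn
    obtain ⟨m, hm, hb⟩ := h n (by omega)
    have := dist_eq hρ (n := n) (by omega)
    exact exists_eq_of_below hσ hG hm hb (by omega)
  set n₀ := N + G.dist r (σ.toFun N')
  obtain ⟨m₀, hm₀, he₀⟩ := key n₀ le_rfl
  refine Quotient.sound ⟨n₀, m₀, fun k => ?_⟩
  obtain ⟨m, hm, he⟩ := key (n₀ + k) (by omega)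
  have h1 := dist_eq hσ hm
  have h2 := dist_eq hσ hm₀
  have h3 := dist_eq hρ (n := n₀) (by omega)
  have h4 := dist_eq hρ (n := n₀ + k) (by omega)
  rw [← he] at h1
  rw [← he₀] at h2
  have : m = m₀ + k := by omega
  rw [he, this]

/-- A ray meets `W` in one of any two consecutive vertices. -/
theorem exists_inr (ρ : Ray Θ.T) (n : ℕ) :
    ∃ m w, n ≤ m ∧ m ≤ n + 1 ∧ ρ.toFun m = .inr w := by
  have ha := ρ.adj n
  rcases hn : ρ.toFun n with v | w
  · rcases hn' : ρ.toFun (n + 1) with v' | w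
    · rw [hn, hn'] at ha
      exact absurd ha (Θ.not_adj_inl _ _)
    · exact ⟨n + 1, w, by omega, le_rfl, hn'⟩
  · exact ⟨n, w, le_rfl, by omega, hn⟩

theorem exists_inl (ρ : Ray Θ.T) (n : ℕ) : ∃ m v, n ≤ m ∧ ρ.toFun m = .inl v := by
  have ha := ρ.adj n
  rcases hn : ρ.toFun n with v | w
  · exact ⟨n, v, le_rfl, hn⟩
  · rcases hn' : ρ.toFun (n + 1) with v | w'
    · exact ⟨n + 1, v, by omega, hn'⟩
    · rw [hn, hn'] at ha
      exact absurd ha (Θ.not_adj_inr _ _)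

/-- The vertices of a ray starting in `V` lie alternately in `V` and in `W`. -/
theorem exists_alternating (ρ : Ray Θ.T) {v : V} (h : ρ.toFun 0 = .inl v) :
    ∃ (v : ℕ → V) (w : ℕ → W), (∀ n, ρ.toFun (2 * n) = .inl (v n)) ∧
      ∀ n, ρ.toFun (2 * n + 1) = .inr (w n) := by
  have h1 : ∀ n v, ρ.toFun n = .inl v → ∃ w, ρ.toFun (n + 1) = .inr w := by
    intro n v hv
    have ha := ρ.adj n
    rcases hn : ρ.toFun (n + 1) with v' | w
    · rw [hv, hn] at ha
      exact absurd ha (Θ.not_adj_inl _ _)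
    · exact ⟨w, rfl⟩
  have h2 : ∀ n w, ρ.toFun n = .inr w → ∃ v, ρ.toFun (n + 1) = .inl v := by
    intro n w hw
    have ha := ρ.adj n
    rcases hn : ρ.toFun (n + 1) with v | w'
    · exact ⟨v, rfl⟩
    · rw [hw, hn] at ha
      exact absurd ha (Θ.not_adj_inr _ _)
  have h3 : ∀ n, ∃ v, ρ.toFun (2 * n) = .inl v := by
    intro n
    induction n with
    | zero => exact ⟨v, h⟩
    | succ n ih =>
      obtain ⟨v, hv⟩ := ih
      obtain ⟨w, hw⟩ := h1 _ v hv
      exact h2 _ w hw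
  choose v hv using h3
  choose w hw using fun n => h1 _ _ (hv n)
  exact ⟨v, w, hv, hw⟩

end Ray

end TreeSystem

/-! ### Ends and the points of the completion outside of the total space -/

namespace TreeSystem.CompatibleMetrics

variable {V W : Type u} {Θ : TreeSystem V W} (D : Θ.CompatibleMetrics)

/-- The part `M_S` of the total space, as a subset of the completion. -/
def csub (S : Set (V ⊕ W)) : Set (UniformSpace.Completion D.MT) :=
  (fun x : D.MT => (x : UniformSpace.Completion D.MT)) '' D.sub S

/-- The vertex spaces along the ray `ρ` converge to the point `z` of the completion. -/
def RayTendsto (ρ : Ray Θ.T) (z : UniformSpace.Completion D.MT) : Prop :=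
  ∀ ε > 0, ∃ N, ∀ n, N ≤ n → ∀ x ∈ D.csub {ρ.toFun n}, dist x z ≤ ε

variable {D}

theorem csub_mono {S S' : Set (V ⊕ W)} (h : S ⊆ S') : D.csub S ⊆ D.csub S' :=
  image_mono (D.sub_mono h)

theorem csub_singleton_subset {S : Set (V ⊕ W)} {u : V ⊕ W} (h : u ∈ S) :
    D.csub {u} ⊆ D.csub S := csub_mono (singleton_subset_iff.2 h)

theorem isClosed_csub_singleton (u : V ⊕ W) : IsClosed (D.csub {u}) :=
  ((D.isCompact_sub_singleton u).image (UniformSpace.Completion.continuous_coe D.MT)).isClosed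

theorem coe_injective {x y : D.MT}
    (h : (x : UniformSpace.Completion D.MT) = y) : x = y := by
  refine D.eq_of_dist_eq_zero ?_
  rw [← UniformSpace.Completion.dist_eq, h, dist_self]

/-- In the completion, the closures of the two sides of a vertex `w` meet in points of `M_w`
only. -/
theorem mem_csub_of_mem_closure {S : Set (V ⊕ W)} {w : W}
    (hS : ∀ t ∈ S, ∀ t' ∉ S, Θ.T.Adj t t' → t = .inr w ∨ t' = .inr w)
    {z : UniformSpace.Completion D.MT} (h₁ : z ∈ closure (D.csub S))
    (h₂ : z ∈ closure (D.csub Sᶜ)) : z ∈ D.csub {.inr w} := by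
  rw [← (isClosed_csub_singleton (D := D) (.inr w)).closure_eq]
  rw [Metric.mem_closure_iff] at h₁ h₂ ⊢
  intro ε hε
  obtain ⟨_, ⟨x, hx, rfl⟩, hzx⟩ := h₁ (ε / 3) (by positivity)
  obtain ⟨_, ⟨y, hy, rfl⟩, hzy⟩ := h₂ (ε / 3) (by positivity)
  obtain ⟨c, hc, hd⟩ := D.exists_dist_eq_add hS hx hy
  refine ⟨c, ⟨c, hc, rfl⟩, ?_⟩
  have h1 := dist_triangle z (x : UniformSpace.Completion D.MT) c
  have h2 := dist_triangle_left (x : UniformSpace.Completion D.MT) y z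
  rw [UniformSpace.Completion.dist_eq] at h1 h2
  have h3 : 0 ≤ dist c y := dist_nonneg
  linarith

theorem crossing_below (r : V ⊕ W) (w : W) : ∀ t ∈ {t | Θ.T.Below r (.inr w) t},
    ∀ t' ∉ {t | Θ.T.Below r (.inr w) t}, Θ.T.Adj t t' → t = .inr w ∨ t' = .inr w :=
  fun _ ht _ ht' ha => Or.inl (Θ.isTree.eq_of_adj_of_below ha ht ht').1

theorem nonempty_csub_ray (ρ : Ray Θ.T) (n : ℕ) : (D.csub {ρ.toFun n}).Nonempty := by
  have ha := ρ.adj n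
  rcases hn : ρ.toFun n with v | w
  · rcases hn' : ρ.toFun (n + 1) with v' | w
    · rw [hn, hn'] at ha
      exact absurd ha (Θ.not_adj_inl _ _)
    · rw [hn, hn'] at ha
      exact ⟨_, D.a w, D.sub_inr_subset ha (D.a_mem_sub w), rfl⟩
  · exact ⟨_, D.a w, D.a_mem_sub w, rfl⟩

namespace RayTendsto

variable {ρ σ : Ray Θ.T} {z z' : UniformSpace.Completion D.MT}

theorem tendsto (h : D.RayTendsto ρ z) {x : ℕ → UniformSpace.Completion D.MT}
    {φ : ℕ → ℕ} (hφ : ∀ n, n ≤ φ n) (hx : ∀ n, x n ∈ D.csub {ρ.toFun (φ n)}) :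
    Tendsto x atTop (𝓝 z) := by
  rw [Metric.tendsto_atTop]
  intro ε hε
  obtain ⟨N, hN⟩ := h (ε / 2) (by positivity)
  exact ⟨N, fun n hn => (hN _ (hn.trans (hφ n)) _ (hx n)).trans_lt (by linarith)⟩

theorem unique (h : D.RayTendsto ρ z) (h' : D.RayTendsto ρ z') : z = z' := by
  choose x hx using nonempty_csub_ray (D := D) ρ
  exact tendsto_nhds_unique (h.tendsto (φ := id) (fun _ => le_rfl) hx)
    (h'.tendsto (φ := id) (fun _ => le_rfl) hx)

theorem congr (h : D.RayTendsto ρ z)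
    (he : Quotient.mk (raySetoid Θ.T) ρ = Quotient.mk (raySetoid Θ.T) σ) :
    D.RayTendsto σ z := by
  obtain ⟨m, n, hmn⟩ := Quotient.exact he
  intro ε hε
  obtain ⟨N, hN⟩ := h ε hε
  refine ⟨n + N, fun k hk x hx => hN (m + (k - n)) (by omega) x ?_⟩
  have := hmn (k - n)
  rwa [this, show n + (k - n) = k by omega]

theorem mem_closure (h : D.RayTendsto ρ z) {S : Set (V ⊕ W)} {N : ℕ}
    (hS : ∀ n, N ≤ n → ρ.toFun n ∈ S) : z ∈ closure (D.csub S) := by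
  choose x hx using nonempty_csub_ray (D := D) ρ
  refine mem_closure_of_tendsto (h.tendsto (φ := id) (fun _ => le_rfl) hx) ?_
  filter_upwards [eventually_ge_atTop N] with n hn
  exact csub_singleton_subset (hS n hn) (hx n)

end RayTendsto

/-- If a ray converges to a point of `M_T`, then the pairs along the ray eventually contain this
point, so the end of the ray is redundant. -/
theorem isRedundant_of_rayTendsto {ρ : Ray Θ.T} {q : D.MT}
    (h : D.RayTendsto ρ q) : D.IsRedundant (Quotient.mk (raySetoid Θ.T) ρ) := by
  obtain ⟨N, hN⟩ := ρ.exists_forall_childOf Θ.isTree (ρ.toFun 0)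
  obtain ⟨u, p, rfl⟩ := D.exists_toMT q
  obtain ⟨n₀, v, hn₀, hv⟩ := ρ.exists_inl (N + Θ.T.dist (ρ.toFun 0) u + 1)
  obtain ⟨vs, ws, hvs, hws⟩ := (ρ.shift n₀).exists_alternating (v := v) hv
  refine ⟨D.toMT u p, 0, fun _ => D.toMT u p, ⟨ρ.shift n₀, vs, ws, ρ.mk_shift n₀, hvs, hws,
    fun n => ?_⟩, fun _ _ => rfl⟩
  have hw : ρ.toFun (n₀ + (2 * n + 1)) = .inr (ws n) := hws n
  obtain ⟨c, hc, he⟩ := mem_csub_of_mem_closure (D := D) (crossing_below (ρ.toFun 0) (ws n))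
    (h.mem_closure (N := n₀ + (2 * n + 1)) fun m hm => by
      rw [mem_ofPred_eq, ← hw]
      exact Ray.below_of_le hN (by omega) hm)
    (subset_closure (csub_singleton_subset (u := u) (fun hb => by
      have h1 := SimpleGraph.Below.dist_le hb
      rw [← hw] at h1
      have h2 := Ray.dist_eq hN (n := n₀ + (2 * n + 1)) (by omega)
      omega) ⟨_, D.mem_sub_of_mem (mem_singleton u) p, rfl⟩))
  rw [← coe_injective he]
  exact hc

/-- Rays that converge to the same point outside of `M_T` are equivalent, since otherwise they
are separated by a pair. -/
theorem mk_eq_mk_of_rayTendsto {ρ σ : Ray Θ.T} {z : UniformSpace.Completion D.MT}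
    (hρ : D.RayTendsto ρ z) (hσ : D.RayTendsto σ z)
    (hz : z ∉ range ((↑) : D.MT → UniformSpace.Completion D.MT)) :
    Quotient.mk (raySetoid Θ.T) ρ = Quotient.mk (raySetoid Θ.T) σ := by
  obtain ⟨N, hN⟩ := ρ.exists_forall_childOf Θ.isTree (ρ.toFun 0)
  obtain ⟨N', hN'⟩ := σ.exists_forall_childOf Θ.isTree (ρ.toFun 0)
  refine Ray.mk_eq_mk_of_below Θ.isTree hN hN' fun n hn => ?_
  obtain ⟨k, w, hk, -, hw⟩ := ρ.exists_inr n
  obtain ⟨m, hm, hb⟩ : ∃ m, N' ≤ m ∧ Θ.T.Below (ρ.toFun 0) (.inr w) (σ.toFun m) := by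
    by_contra! hc
    obtain ⟨c, -, he⟩ := mem_csub_of_mem_closure (D := D) (crossing_below (ρ.toFun 0) w)
      (hρ.mem_closure (N := k) fun m hm => by
        rw [mem_ofPred_eq, ← hw]
        exact Ray.below_of_le hN (by omega) hm)
      (hσ.mem_closure (N := N') hc)
    exact hz ⟨c, he⟩
  refine ⟨m, hm, Relation.ReflTransGen.trans (Ray.below_of_le hN hn hk) ?_⟩
  rw [hw]
  exact hb

namespace IsShrinking

variable {v₀ : V} (hD : D.IsShrinking v₀)

include hD

/-- The branches behind the vertices `w` of a ray become small. -/
theorem exists_ray_bound (ρ : Ray Θ.T) {ε : ℝ} (hε : 0 < ε) : ∃ N, ∀ n, N ≤ n → ∀ w,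
    ρ.toFun n = .inr w → ∀ z ∈ closure (D.csub {t | Θ.T.Below (.inl v₀) (.inr w) t}),
      dist z (D.a w : UniformSpace.Completion D.MT) ≤ ε := by
  obtain ⟨δ, hδ, hb⟩ := hD.exists_len_bound hε
  have hfin : {n | ∃ w, ρ.toFun n = .inr w ∧ δ ≤ D.len w}.Finite := by
    refine (((hD.finite_len_ge hδ).image Sum.inr).preimage ρ.injective.injOn).subset ?_
    rintro n ⟨w, hw, hl⟩
    exact ⟨w, hl, hw.symm⟩
  obtain ⟨N, hN⟩ := hfin.bddAbove
  refine ⟨N + 1, fun n hn w hw z hz => ?_⟩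
  have hl : D.len w < δ := by
    by_contra hl
    have := hN ⟨w, hw, not_lt.1 hl⟩
    omega
  refine closure_minimal (t := {z | dist z (D.a w : UniformSpace.Completion D.MT) ≤ ε}) ?_
    (isClosed_le (by fun_prop) (by fun_prop)) hz
  rintro _ ⟨y, hy, rfl⟩
  obtain ⟨t, ht, hyt⟩ := D.mem_sub_iff.1 hy
  rw [mem_ofPred_eq, UniformSpace.Completion.dist_eq]
  exact hb w hl t ht y hyt

/-- A descending ray converges to any point in the closures of all the branches that it enters. -/
theorem rayTendsto_of_mem_closure {ρ : Ray Θ.T} {N : ℕ}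
    (hρ : ∀ n, N ≤ n → Θ.T.ChildOf (.inl v₀) (ρ.toFun n) (ρ.toFun (n + 1)))
    {z : UniformSpace.Completion D.MT}
    (hz : ∀ n, N ≤ n → z ∈ closure (D.csub {t | Θ.T.Below (.inl v₀) (ρ.toFun n) t})) :
    D.RayTendsto ρ z := by
  intro ε hε
  obtain ⟨N', hN'⟩ := hD.exists_ray_bound ρ (half_pos hε)
  obtain ⟨m, w, hm, -, hw⟩ := ρ.exists_inr (max N N')
  have h1 := hN' m (by omega) w hw
  refine ⟨m, fun n hn x hx => ?_⟩
  have hb := Ray.below_of_le hρ (n := m) (m := n) (by omega) hn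
  rw [hw] at hb
  have h2 := h1 x (subset_closure (csub_singleton_subset hb hx))
  have h3 := h1 z (hw ▸ hz m (by omega))
  have h4 := dist_triangle_right x z (D.a w)
  linarith

theorem exists_rayTendsto (ρ : Ray Θ.T) : ∃ z, D.RayTendsto ρ z := by
  have := hD.compactSpace_completion
  obtain ⟨N, hN⟩ := ρ.exists_forall_childOf Θ.isTree (.inl v₀)
  choose x hx using nonempty_csub_ray (D := D) ρ
  obtain ⟨z, φ, hφ, hz⟩ := CompactSpace.tendsto_subseq x
  refine ⟨z, hD.rayTendsto_of_mem_closure hN fun n hn => mem_closure_of_tendsto hz ?_⟩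
  filter_upwards [eventually_ge_atTop n] with k hk
  exact csub_singleton_subset (Ray.below_of_le hN hn (hk.trans (hφ.id_le k))) (hx (φ k))

theorem exists_endLimit : ∃ α : Θ.Ends → UniformSpace.Completion D.MT,
    ∀ ρ : Ray Θ.T, D.RayTendsto ρ (α (Quotient.mk (raySetoid Θ.T) ρ)) := by
  have : ∀ x : Θ.Ends, ∃ z, ∀ ρ : Ray Θ.T, Quotient.mk (raySetoid Θ.T) ρ = x →
      D.RayTendsto ρ z := by
    intro x
    induction x using Quotient.inductionOn with
    | h ρ =>
      obtain ⟨z, hz⟩ := hD.exists_rayTendsto ρ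
      exact ⟨z, fun σ hσ => hz.congr hσ.symm⟩
  choose α hα using this
  exact ⟨α, fun ρ => hα _ ρ rfl⟩

/-- A point outside of `M_T` in the closure of the branch at `u` lies in the closure of the branch
at a child of `u`: only finitely many of these branches are not close to `M_u`. -/
theorem exists_childOf_mem_closure {z : UniformSpace.Completion D.MT}
    (hz : z ∉ range ((↑) : D.MT → UniformSpace.Completion D.MT)) {u : V ⊕ W}
    (hu : z ∈ closure (D.csub {t | Θ.T.Below (.inl v₀) u t})) :
    ∃ u', Θ.T.ChildOf (.inl v₀) u u' ∧ z ∈ closure (D.csub {t | Θ.T.Below (.inl v₀) u' t}) := by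
  have hzu : z ∉ D.csub {u} := fun ⟨x, _, hx⟩ => hz ⟨x, hx⟩
  obtain ⟨η, hη, hball⟩ :=
    Metric.isOpen_iff.1 (isClosed_csub_singleton (D := D) u).isOpen_compl z hzu
  have hfar : ∀ x ∈ D.csub {u}, η ≤ dist x z := fun x hx => by
    by_contra hlt
    exact hball (Metric.mem_ball.2 (not_le.1 hlt)) hx
  obtain ⟨A, hA, hAc, hAf⟩ : ∃ A : Set (V ⊕ W), A.Finite ∧
      (∀ u' ∈ A, Θ.T.ChildOf (.inl v₀) u u') ∧ ∀ u', Θ.T.ChildOf (.inl v₀) u u' → u' ∉ A →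
        ∀ y ∈ D.csub {t | Θ.T.Below (.inl v₀) u' t}, η / 2 ≤ dist y z := by
    obtain ⟨δ, hδ, hb⟩ := hD.exists_len_bound (half_pos hη)
    rcases u with v | w
    · refine ⟨{u' | Θ.T.ChildOf (.inl v₀) (.inl v) u' ∧ ∃ w, u' = .inr w ∧ δ ≤ D.len w},
        ((hD.finite_len_ge hδ).image Sum.inr).subset ?_, fun _ h => h.1, fun u' hc hn => ?_⟩
      · rintro _ ⟨-, w, rfl, hw⟩
        exact ⟨w, hw, rfl⟩
      · rcases u' with v' | w
        · exact absurd hc.1 (Θ.not_adj_inl _ _)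
        · have hl : D.len w < δ := by
            by_contra hl
            exact hn ⟨hc, w, rfl, not_lt.1 hl⟩
          rintro _ ⟨y, hy, rfl⟩
          obtain ⟨t, ht, hyt⟩ := D.mem_sub_iff.1 hy
          have h1 := hb w hl t ht y hyt
          have h2 := hfar (D.a w) ⟨_, D.sub_inr_subset hc.1 (D.a_mem_sub w), rfl⟩
          have h3 := dist_triangle_left (D.a w : UniformSpace.Completion D.MT) z y
          rw [UniformSpace.Completion.dist_eq] at h3
          linarith
    · exact ⟨{u' | Θ.T.ChildOf (.inl v₀) (.inr w) u'},
        (Θ.finite_valence w).subset fun _ h => h.1, fun _ h => h, fun u' hc hn => absurd hc hn⟩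
  have hcov : D.csub {t | Θ.T.Below (.inl v₀) u t} ⊆ {y | η / 2 ≤ dist y z} ∪
      ⋃ u' ∈ A, closure (D.csub {t | Θ.T.Below (.inl v₀) u' t}) := by
    rintro _ ⟨y, hy, rfl⟩
    obtain ⟨t, ht, hyt⟩ := D.mem_sub_iff.1 hy
    rcases Relation.ReflTransGen.cases_head ht with rfl | ⟨u', hc, hb⟩
    · have := hfar y ⟨y, hyt, rfl⟩
      exact Or.inl (by rw [mem_ofPred_eq]; linarith)
    · have hmem : (y : UniformSpace.Completion D.MT) ∈ D.csub {t | Θ.T.Below (.inl v₀) u' t} :=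
        ⟨y, D.sub_mono (singleton_subset_iff.2 hb) hyt, rfl⟩
      by_cases hu' : u' ∈ A
      · exact Or.inr (mem_biUnion hu' (subset_closure hmem))
      · exact Or.inl (hAf u' hc hu' _ hmem)
  have hclosed : IsClosed ({y | η / 2 ≤ dist y z} ∪
      ⋃ u' ∈ A, closure (D.csub {t | Θ.T.Below (.inl v₀) u' t})) :=
    (isClosed_le (by fun_prop) (by fun_prop)).union (hA.isClosed_biUnion fun _ _ => isClosed_closure)
  rcases closure_minimal hcov hclosed hu with h | h
  · rw [mem_ofPred_eq, dist_self] at h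
    linarith
  · obtain ⟨u', hu', h⟩ := mem_iUnion₂.1 h
    exact ⟨u', hAc u' hu', h⟩

/-- Every point of the completion outside of `M_T` is the limit of a ray. -/
theorem exists_ray_of_notMem {z : UniformSpace.Completion D.MT}
    (hz : z ∉ range ((↑) : D.MT → UniformSpace.Completion D.MT)) :
    ∃ ρ : Ray Θ.T, D.RayTendsto ρ z := by
  have h₀ : z ∈ closure (D.csub {t | Θ.T.Below (.inl v₀) (.inl v₀) t}) := by
    have : D.csub {t | Θ.T.Below (.inl v₀) (.inl v₀) t} =
        range ((↑) : D.MT → UniformSpace.Completion D.MT) := by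
      refine (image_subset_range _ _).antisymm ?_
      rintro _ ⟨x, rfl⟩
      obtain ⟨u, p, rfl⟩ := D.exists_toMT x
      exact ⟨_, D.mem_sub_of_mem (S := {t | Θ.T.Below (.inl v₀) (.inl v₀) t})
        (Θ.isTree.below_root _ u) p, rfl⟩
    rw [this]
    exact UniformSpace.Completion.denseRange_coe z
  let P := {u : V ⊕ W // z ∈ closure (D.csub {t | Θ.T.Below (.inl v₀) u t})}
  have hnext : ∀ u : P, ∃ u' : P, Θ.T.ChildOf (.inl v₀) u.1 u'.1 := fun u => by
    obtain ⟨u', h1, h2⟩ := hD.exists_childOf_mem_closure hz u.2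
    exact ⟨⟨u', h2⟩, h1⟩
  choose nxt hnxt using hnext
  let f : ℕ → P := fun n => nxt^[n] ⟨.inl v₀, h₀⟩
  have hf : ∀ n, Θ.T.ChildOf (.inl v₀) (f n).1 (f (n + 1)).1 := fun n => by
    change Θ.T.ChildOf _ _ (nxt^[n + 1] _).1
    rw [Function.iterate_succ_apply']
    exact hnxt _
  have hmono : StrictMono fun n => Θ.T.dist (.inl v₀) (f n).1 :=
    strictMono_nat_of_lt_succ fun n => by rw [(hf n).2]; omega
  let ρ : Ray Θ.T :=
    { toFun := fun n => (f n).1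
      injective := fun m n h => hmono.injective (congrArg (Θ.T.dist (.inl v₀)) h)
      adj := fun n => (hf n).1 }
  exact ⟨ρ, hD.rayTendsto_of_mem_closure (N := 0) (fun n _ => hf n) fun n _ => (f n).2⟩

end IsShrinking

theorem IsRedundant.mem_range {x : Θ.Ends} (hx : D.IsRedundant x)
    {z : UniformSpace.Completion D.MT}
    (h : ∀ ρ : Ray Θ.T, Quotient.mk (raySetoid Θ.T) ρ = x → D.RayTendsto ρ z) :
    z ∈ range ((↑) : D.MT → UniformSpace.Completion D.MT) := by
  obtain ⟨q, N, p, ⟨ρ, v, w, hρ, -, hw, hp⟩, hq⟩ := hx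
  have hlim : Tendsto (fun n => (p n : UniformSpace.Completion D.MT)) atTop (𝓝 z) :=
    (h ρ hρ).tendsto (φ := fun n => 2 * n + 1) (fun n => by omega)
      fun n => ⟨p n, hw n ▸ hp n, rfl⟩
  refine ⟨q, tendsto_nhds_unique (tendsto_const_nhds.congr' ?_) hlim⟩
  filter_upwards [eventually_gt_atTop N] with n hn
  rw [hq n hn]

end TreeSystem.CompatibleMetrics

theorem theoremD {V W : Type u} (Θ : TreeSystem V W) (D : Θ.CompatibleMetrics) (v₀ : V)
    (hD : D.IsShrinking v₀) :
    -- the quotient pseudometric on `M_T` is a metric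
    (∀ x y : D.MT, dist x y = 0 → x = y) ∧
    -- `M_T` is totally bounded and its completion is compact
    TotallyBounded (univ : Set D.MT) ∧
    CompactSpace (UniformSpace.Completion D.MT) ∧
    -- the vertex and edge spaces embed isometrically into the completion
    (∀ u : V ⊕ W, Isometry fun p : D.X u => (D.toMT u p : UniformSpace.Completion D.MT)) ∧
    -- the natural map `M_T → M_Θ` exists and is unique
    (∃! γ : D.MT → D.MΘ, D.IsNaturalMap γ) ∧
    ∀ γ : D.MT → D.MΘ, D.IsNaturalMap γ →
      -- it has a unique continuous extension, which is a homeomorphism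
      ∃ Γ : UniformSpace.Completion D.MT ≃ₜ D.MΘ,
        (∀ x : D.MT, Γ x = γ x) ∧
        (∀ g : UniformSpace.Completion D.MT → D.MΘ, Continuous g →
          (∀ x : D.MT, g x = γ x) → g = Γ) ∧
        -- the associated sequences of ends converge in the completion and in `M_Θ`;
        -- this identifies the non-redundant ends with the points outside `M_T`,
        -- and the extension respects this identification
        ∃ (α : Θ.Ends → UniformSpace.Completion D.MT) (γ' : Θ.Ends → D.MΘ),
          (∀ (x : Θ.Ends) (p : ℕ → D.MT), D.IsAssociated x p →
            Tendsto (fun n => (p n : UniformSpace.Completion D.MT)) atTop (𝓝 (α x)) ∧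
            Tendsto (fun n => γ (p n)) atTop (𝓝 (γ' x))) ∧
          BijOn α D.nonRedundant
            (range ((↑) : D.MT → UniformSpace.Completion D.MT))ᶜ ∧
          BijOn γ' D.nonRedundant (range γ)ᶜ ∧
          ∀ x ∈ D.nonRedundant, Γ (α x) = γ' x := by
  refine ⟨fun x y => D.eq_of_dist_eq_zero, hD.totallyBounded, hD.compactSpace_completion,
    fun u => Isometry.of_dist_eq fun p q => ?_, D.existsUnique_naturalMap, fun γ hγ => ?_⟩
  · rw [UniformSpace.Completion.dist_eq, D.dist_toMT]
  obtain ⟨Γ, hΓ⟩ := hD.exists_homeomorph hγ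
  obtain ⟨α, hα⟩ := hD.exists_endLimit
  have hα' : ∀ (x : Θ.Ends) (ρ : TreeSystem.Ray Θ.T),
      Quotient.mk (TreeSystem.raySetoid Θ.T) ρ = x → D.RayTendsto ρ (α x) := by
    rintro _ ρ rfl
    exact hα ρ
  have hlim : ∀ (x : Θ.Ends) (p : ℕ → D.MT), D.IsAssociated x p →
      Tendsto (fun n => (p n : UniformSpace.Completion D.MT)) atTop (𝓝 (α x)) := by
    rintro x p ⟨ρ, v, w, hρ, -, hw, hp⟩
    exact (hα' x ρ hρ).tendsto (φ := fun n => 2 * n + 1) (fun n => by omega)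
      fun n => ⟨p n, hw n ▸ hp n, rfl⟩
  have hbij : BijOn α D.nonRedundant
      (range ((↑) : D.MT → UniformSpace.Completion D.MT))ᶜ := by
    have hmaps : MapsTo α D.nonRedundant
        (range ((↑) : D.MT → UniformSpace.Completion D.MT))ᶜ := by
      rintro x hx ⟨q, hq⟩
      induction x using Quotient.inductionOn with
      | h ρ => exact hx (TreeSystem.CompatibleMetrics.isRedundant_of_rayTendsto (hq ▸ hα ρ))
    refine ⟨hmaps, fun x hx y hy hxy => ?_, fun z hz => ?_⟩
    · have hz := hmaps hx
      induction x using Quotient.inductionOn with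
      | h ρ =>
        induction y using Quotient.inductionOn with
        | h σ => exact TreeSystem.CompatibleMetrics.mk_eq_mk_of_rayTendsto (hα ρ) (hxy ▸ hα σ) hz
    · obtain ⟨ρ, hρ⟩ := hD.exists_ray_of_notMem hz
      have he := hρ.unique (hα ρ)
      refine ⟨Quotient.mk (TreeSystem.raySetoid Θ.T) ρ, fun hr => hz ?_, he.symm⟩
      rw [he]
      exact hr.mem_range (hα' _)
  have himage : Γ '' (range ((↑) : D.MT → UniformSpace.Completion D.MT))ᶜ = (range γ)ᶜ := by
    rw [image_compl_eq Γ.bijective, ← range_comp]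
    exact congrArg (fun f => (range f)ᶜ) (funext hΓ)
  refine ⟨Γ, hΓ, fun g hg hgx => ?_, α, Γ ∘ α, fun x p hp => ⟨hlim x p hp, ?_⟩, hbij, ?_,
    fun x _ => rfl⟩
  · refine UniformSpace.Completion.denseRange_coe.equalizer hg Γ.continuous ?_
    funext x
    exact (hgx x).trans (hΓ x).symm
  · have := (Γ.continuous.tendsto _).comp (hlim x p hp)
    refine this.congr fun n => ?_
    exact hΓ (p n)
  · rw [← himage]
    exact Γ.injective.injOn.bijOn_image.comp hbij
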